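/- Let $A$ be a finite-dimensional basic algebra over $\mathbb{C}$ (equivalently $A=\mathbb{C}Q/I$ for a finite quiver $Q$ and an admissible ideal $I$), and let $e_i$ ($i\in Q_0$) be the complete set of primitive orthogonal idempotents given by the vertices of $Q$. Put $P_i=Ae_i$. The dimension vector of a finite-dimensional representation ($A$-module) $M$ is $(\underline{\dim}\,M)(i)=\dim_{\mathbb{C}}e_iM$, and a weight $\delta\in\mathbb{Z}^{Q_0}$ is evaluated on it by the dot product. Write $\delta=\delta_+-\delta_-$ with $\delta_+=\max(\delta,0)$, $\delta_-=\max(-\delta,0)$, and $\mathrm{PHom}(\delta)=\mathrm{Hom}_A(P(\delta_-),P(\delta_+))$, where $P(\beta)=\bigoplus_i\beta(i)P_i$. For $d\in\mathrm{PHom}(\delta)$ and a finite-dimensional representation $N$, let $\hom(d,N)$ and $\mathrm{e}(d,N)$ be the dimensions of the kernel and of the cokernel of the induced map $\mathrm{Hom}_A(P(\delta_+),N)\to\mathrm{Hom}_A(P(\delta_-),N)$, and let $\hom(\delta,N)$ and $\mathrm{e}(\delta,N)$ be their values for a general $d$ (i.e. for all $d$ in some non-empty Zariski-open subset of $\mathrm{PHom}(\delta)$).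 Consider the following classes of finite-dimensional representations: $$\mathcal{F}(\bar\delta)=\{N\mid \hom(n\delta,N)=0\text{ for some }n\geq 1\},\qquad \mathcal{T}(\bar\delta)=\{X\mid \mathrm{Hom}(X,N)=0\text{ for all }N\in\mathcal{F}(\bar\delta)\},$$ $$\check{\mathcal{T}}(\bar\delta)=\{L\mid \mathrm{e}(n\delta,L)=0\text{ for some }n\geq 1\},\qquad \check{\mathcal{F}}(\bar\delta)=\{Y\mid \mathrm{Hom}(L,Y)=0\text{ for all }L\in\check{\mathcal{T}}(\bar\delta)\}.$$ Then $(\mathcal{T}(\bar\delta),\mathcal{F}(\bar\delta))$ and $(\check{\mathcal{T}}(\bar\delta),\check{\mathcal{F}}(\bar\delta))$ are torsion pairs, i.e. in each pair each of the two classes is the $\mathrm{Hom}$-orthogonal of the other. For a finite-dimensional representation $M$, let $t_{\bar\delta}(M)$ and $\check t_{\bar\delta}(M)$ be the torsion parts of $M$, i.e. the sums of all subrepresentations of $M$ belonging to $\mathcal{T}(\bar\delta)$ and to $\check{\mathcal{T}}(\bar\delta)$ respectively, and put $f_{\bar\delta}(M)=M/t_{\bar\delta}(M)$, $\check f_{\bar\delta}(M)=M/\check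 t_{\bar\delta}(M)$. Let $\mathcal{L}(\delta,M)$ be the set of all subrepresentations $L\subseteq M$ at which $\delta(\underline{\dim}\,L)$ attains its maximum over all subrepresentations of $M$. For every finite-dimensional representation $M$ and every $\delta\in\mathbb{Z}^{Q_0}$, the set $\mathcal{L}(\delta,M)$ has a least element $L_{\min}$ and a greatest element $L_{\max}$ with respect to inclusion, and $$t_{\bar\delta}(M)=L_{\min},\quad f_{\bar\delta}(M)=M/L_{\min},\qquad \check t_{\bar\delta}(M)=L_{\max},\quad \check f_{\bar\delta}(M)=M/L_{\max}.$$ Moreover, for every $L\in\mathcal{L}(\delta,M)$, $$\mathrm{Hom}(t_{\bar\delta}(M),M/L)=0\quad\text{and}\quad \mathrm{Hom}(L,\check f_{\bar\delta}(M))=0.$$ -/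

import Mathlib

open Module

universe u v w

namespace TorsionTheory

noncomputable section

/-! ### General elements of a complex vector space (Zariski topology) -/

/-- The algebra of polynomial functions on a complex vector space: it is generated by the
linear forms. -/
def polyFun (V : Type*) [AddCommGroup V] [Module ℂ V] : Subalgebra ℂ (V → ℂ) :=
  Algebra.adjoin ℂ {f : V → ℂ | ∃ φ : Dual ℂ V, f = fun x => φ x}

/-- Zariski-open subsets of a complex vector space: complements of common zero loci of sets of
polynomial functions. -/
def IsZariskiOpen {V : Type*} [AddCommGroup V] [Module ℂ V] (U : Set V) : Prop :=
  ∃ S : Set (V → ℂ), (∀ f ∈ S, f ∈ polyFun V) ∧ U = {x | ∃ f ∈ S, f x ≠ 0}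

/-- A general element of `V` satisfies `p`: there is a non-empty (hence dense) Zariski-open subset
of `V` all of whose elements satisfy `p`. -/
def ForGeneral {V : Type*} [AddCommGroup V] [Module ℂ V] (p : V → Prop) : Prop :=
  ∃ U : Set V, IsZariskiOpen U ∧ U.Nonempty ∧ ∀ x ∈ U, p x

section Presentations

variable {A : Type u} [Ring A] [Algebra ℂ A] {ι : Type w} [Fintype ι]

/-- The idempotents `e i` are the vertices of the (Gabriel) quiver of the basic algebra `A`: they
form a complete set of primitive orthogonal idempotents, and the indecomposable projective modules
`A e i` are pairwise non-isomorphic. -/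
structure IsBasicVertexSet (e : ι → A) : Prop where
  complete : CompleteOrthogonalIdempotents e
  ne_zero : ∀ i, e i ≠ 0
  primitive : ∀ i, ∀ f : A, IsIdempotentElem f → e i * f = f → f * e i = f → f = 0 ∨ f = e i
  basic : ∀ i j, i ≠ j →
    IsEmpty ((Ideal.span {e i} : Ideal A) ≃ₗ[A] (Ideal.span {e j} : Ideal A))

/-- The indecomposable projective `P i = A e i` (a left ideal of `A`). -/
abbrev Proj (e : ι → A) (i : ι) : Type u := (Ideal.span {e i} : Ideal A)

/-- `P(β)`, the direct sum of `β i` copies of `P i` over all vertices `i`. -/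
abbrev ProjSum (e : ι → A) (β : ι → ℕ) : Type (max u w) := (i : ι) → Fin (β i) → Proj e i

/-- The positive part of a weight. -/
def posPart (δ : ι → ℤ) : ι → ℕ := fun i => (δ i).toNat

/-- The negative part of a weight, so that `δ = posPart δ - negPart δ`. -/
def negPart (δ : ι → ℤ) : ι → ℕ := fun i => (-δ i).toNat

/-- `PHom(δ) = Hom_A(P(δ₋), P(δ₊))`, the space of projective presentations of weight `δ`. -/
abbrev PHom (e : ι → A) (δ : ι → ℤ) : Type (max u w) :=
  ProjSum e (negPart δ) →ₗ[A] ProjSum e (posPart δ)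

variable (N : Type v) [AddCommGroup N] [Module ℂ N] [Module A N] [IsScalarTower ℂ A N]

/-- The map `Hom_A(P₊, N) → Hom_A(P₋, N)` induced by a presentation `d : P₋ → P₊`. -/
def presMap {e : ι → A} {δ : ι → ℤ} (d : PHom e δ) :
    (ProjSum e (posPart δ) →ₗ[A] N) →ₗ[ℂ] (ProjSum e (negPart δ) →ₗ[A] N) :=
  LinearMap.lcomp ℂ N d

/-- `hom(d, N)`, the dimension of the kernel `Hom(d, N)` of the induced map. -/
def homDim {e : ι → A} {δ : ι → ℤ} (d : PHom e δ) : ℕ :=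
  finrank ℂ (LinearMap.ker (presMap N d))

/-- `e(d, N)`, the dimension of the cokernel `E(d, N)` of the induced map. -/
def eDim {e : ι → A} {δ : ι → ℤ} (d : PHom e δ) : ℕ :=
  finrank ℂ ((ProjSum e (negPart δ) →ₗ[A] N) ⧸ LinearMap.range (presMap N d))

/-- `hom(δ, N) = h`: the value of `hom(d, N)` for a general `d` in `PHom(δ)` is `h`. -/
def GenHomEq (e : ι → A) (δ : ι → ℤ) (h : ℕ) : Prop :=
  ForGeneral fun d : PHom e δ => homDim N d = h

/-- `e(δ, N) = h`: the value of `e(d, N)` for a general `d` in `PHom(δ)` is `h`. -/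
def GenEEq (e : ι → A) (δ : ι → ℤ) (h : ℕ) : Prop :=
  ForGeneral fun d : PHom e δ => eDim N d = h

/-- The dimension vector: its entry at `i` is the dimension of `e i • N`. -/
def dimVec (e : ι → A) (i : ι) : ℕ :=
  finrank ℂ (LinearMap.range (Algebra.lsmul ℂ ℂ N (e i)))

/-- `δ(dim N)`, the dot product of a weight with the dimension vector. -/
def weight (e : ι → A) (δ : ι → ℤ) : ℤ := ∑ i, δ i * (dimVec N e i : ℤ)

/-- `𝓛(δ, N)`: the subrepresentations `L` of `N` at which `δ(dim L)` attains its maximum. -/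
def maxSubs (e : ι → A) (δ : ι → ℤ) : Set (Submodule A N) :=
  {L | ∀ L' : Submodule A N, weight L' e δ ≤ weight L e δ}

end Presentations

/-! ### Classes of representations and torsion pairs -/

/-- Classes (full subcategories) of `A`-modules. -/
abbrev RepClass (A : Type u) [Ring A] [Algebra ℂ A] : Type (max u (v + 1)) :=
  ∀ (N : Type v) [AddCommGroup N] [Module ℂ N] [Module A N] [IsScalarTower ℂ A N], Prop

section Torsion

variable {A : Type u} [Ring A] [Algebra ℂ A]

/-- The finite-dimensional `X` with `Hom_A(X, N) = 0` for all `N` in `F`. -/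
def leftPerp (F : RepClass.{u, v} A) : RepClass.{u, v} A := fun X _ _ _ _ =>
  FiniteDimensional ℂ X ∧
    ∀ (N : Type v) [AddCommGroup N] [Module ℂ N] [Module A N] [IsScalarTower ℂ A N],
      F N → ∀ φ : X →ₗ[A] N, φ = 0

/-- The finite-dimensional `Y` with `Hom_A(L, Y) = 0` for all `L` in `T`. -/
def rightPerp (T : RepClass.{u, v} A) : RepClass.{u, v} A := fun Y _ _ _ _ =>
  FiniteDimensional ℂ Y ∧
    ∀ (L : Type v) [AddCommGroup L] [Module ℂ L] [Module A L] [IsScalarTower ℂ A L],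
      T L → ∀ φ : L →ₗ[A] Y, φ = 0

/-- `(T, F)` is a torsion pair in the category of finite-dimensional representations of `A`:
each of the two classes is the `Hom`-orthogonal of the other one. -/
structure IsTorsionPair (T F : RepClass.{u, v} A) : Prop where
  mem_left_iff : ∀ (X : Type v) [AddCommGroup X] [Module ℂ X] [Module A X] [IsScalarTower ℂ A X],
    T X ↔ leftPerp F X
  mem_right_iff : ∀ (Y : Type v) [AddCommGroup Y] [Module ℂ Y] [Module A Y] [IsScalarTower ℂ A Y],
    F Y ↔ rightPerp T Y

variable (M : Type v) [AddCommGroup M] [Module ℂ M] [Module A M] [IsScalarTower ℂ A M]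

/-- The torsion part `t(M)` of `M` for a torsion class `T`: the sum of all subrepresentations
of `M` that belong to `T`. -/
def torsionSub (T : RepClass.{u, v} A) : Submodule A M := sSup {L : Submodule A M | T L}

/-- The torsion-free part `f(M) = M / t(M)`. -/
abbrev torsionFreeQuot (T : RepClass.{u, v} A) : Type v := M ⧸ torsionSub M T

end Torsion

section Classes

variable {A : Type u} [Ring A] [Algebra ℂ A] {ι : Type w} [Fintype ι]

/-- The torsion-free class `𝓕(δ̄)`: all `N` with `hom(nδ, N) = 0` for some positive `n`. -/
def barF (e : ι → A) (δ : ι → ℤ) : RepClass.{u, v} A := fun N _ _ _ _ =>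
  FiniteDimensional ℂ N ∧ ∃ n : ℕ, 0 < n ∧ GenHomEq N e (n • δ) 0

/-- The torsion class `𝓣(δ̄)` that belongs to `𝓕(δ̄)`. -/
def barT (e : ι → A) (δ : ι → ℤ) : RepClass.{u, v} A := leftPerp (barF e δ)

/-- The torsion class `𝓣̌(δ̄)`: all `L` with `e(nδ, L) = 0` for some positive `n`. -/
def checkT (e : ι → A) (δ : ι → ℤ) : RepClass.{u, v} A := fun L _ _ _ _ =>
  FiniteDimensional ℂ L ∧ ∃ n : ℕ, 0 < n ∧ GenEEq L e (n • δ) 0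

/-- The torsion-free class `𝓕̌(δ̄)` that belongs to `𝓣̌(δ̄)`. -/
def checkF (e : ι → A) (δ : ι → ℤ) : RepClass.{u, v} A := rightPerp (checkT e δ)

end Classes

end

end TorsionTheory

/-! The heart of the matter is a weight criterion for the two classes: `N` lies in `barF` exactly
when every submodule has weight at most 0 (`barF_iff`), and in `checkT` exactly when `N` itself has
maximal weight among its submodules (`checkT_iff`). One direction is the Euler characteristic
identity `hom(d, N) - e(d, N) = δ(dim N)`, applied to a submodule or a quotient, to which the
vanishing of `hom` or `e` passes.

The other direction needs presentations of weight `n δ` with `hom` or `e` equal to zero. The maps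
`Hom(P₊, N) → Hom(P₋, N)` induced by presentations of weight `δ` form a space `B`, and an `n × n`
block matrix over `B` is induced by a presentation of weight `n δ`. So the question is how large the
rank of such blow-ups can be, relative to `n`. This is the theory of non-commutative rank. The
maximal rank at size `n` is a multiple of `n` (`exists_max_rank_blowUp_eq_mul`), because the generic
matrices may be specialised into a division algebra of degree `n`. Hence the relative ranks are
bounded integers and their supremum is attained; at a maximiser the Wong sequence yields a subspace
`U` whose codimension defect `dim U - dim BU` matches the corank (`exists_blockMap_and_shrunk`). The
sum of the images of the maps in `U` is a submodule of `N` of weight at least that defect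
(`exists_le_weight`), using projectivity of `P₋`. If all weights obey the stated bound, the defect
is too small to obstruct injectivity, respectively surjectivity, and semicontinuity spreads the
vanishing to general presentations.

Given the criterion, everything else is lattice theory. The weight is a modular function on
submodules, so its maximisers are closed under sums and intersections and have a least and a
greatest member. For a maximiser `L`, the quotient `M / L` lies in `barF` and `L` lies in `checkT`;
minimality puts `L_min` in `barT`, and maximality puts `M / L_max` in `checkF`. The torsion parts,
the orthogonality of the pairs and the vanishing of the `Hom` spaces follow. -/

namespace TorsionTheory

noncomputable section

section QuantumAlgebra

/-! ### Division algebras of degree `n` that are split by a field extension -/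

/-- The lexicographically ordered group `ℤ²` of exponents of monomials in two variables. -/
abbrev Exps : Type := ℤ ×ₗ ℤ

/-- The field of Hahn series over `ℂ` with exponents in `ℤ²`. -/
abbrev HahnField : Type := HahnSeries Exps ℂ

/-- Lowest terms multiply: a pair of exponents with sum `g + h`, other than `(g, h)`, has a
component below its bound. -/
theorem coeff_mul_of_forall_lt {x y : HahnField} {g h : Exps} (hx : ∀ p < g, x.coeff p = 0)
    (hy : ∀ q < h, y.coeff q = 0) : (x * y).coeff (g + h) = x.coeff g * y.coeff h := by
  rw [HahnSeries.coeff_mul]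
  refine Finset.sum_eq_single (g, h) ?_ ?_
  · rintro ⟨p, q⟩ hpq hne
    rw [Finset.mem_antidiagonal] at hpq
    obtain ⟨-, -, hpq⟩ := hpq
    simp only at hpq ⊢
    rcases lt_trichotomy p g with hp | hp | hp
    · rw [hx p hp, zero_mul]
    · subst hp
      exact absurd (by rw [add_left_cancel hpq]) hne
    · have : q < h := by
        by_contra hq
        exact absurd hpq (ne_of_gt (add_lt_add_of_lt_of_le hp (not_lt.1 hq)))
      rw [hy q this, mul_zero]
  · intro hn
    by_contra hne
    exact hn (Finset.mem_antidiagonal.2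
      ⟨left_ne_zero_of_mul hne, right_ne_zero_of_mul hne, rfl⟩)

variable (n : ℕ) [NeZero n]

/-- The product of powers of the clock and the shift matrix of size `n`. -/
def clockShift (g : Exps) : Matrix (ZMod n) (ZMod n) ℂ := fun a b =>
  ZMod.stdAddChar (((ofLex g).1 : ZMod n) * a) * if a = b + ((ofLex g).2 : ZMod n) then 1 else 0

theorem clockShift_zero : clockShift n 0 = 1 := by
  ext a b
  simp [clockShift, Matrix.one_apply]

/-- Clock and shift commute up to a root of unity, so the monomials form a projective representation
of `ℤ²`. -/
theorem clockShift_mul (g h : Exps) :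
    clockShift n g * clockShift n h =
      (ZMod.stdAddChar (-((ofLex h).1 * (ofLex g).2 : ZMod n)) : ℂ) • clockShift n (g + h) := by
  ext a b
  rw [Matrix.mul_apply, Finset.sum_eq_single (a - ((ofLex g).2 : ZMod n))]
  · simp only [clockShift, Matrix.smul_apply, smul_eq_mul, ofLex_add, Prod.fst_add, Prod.snd_add,
      Int.cast_add, sub_add_cancel, if_true, mul_one]
    have h1 : (a - ((ofLex g).2 : ZMod n) = b + ((ofLex h).2 : ZMod n)) ↔
        (a = b + (((ofLex g).2 : ZMod n) + ((ofLex h).2 : ZMod n))) := by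
      rw [sub_eq_iff_eq_add]; ring_nf
    simp only [h1, ← mul_assoc, ← AddChar.map_add_eq_mul]
    congr 2
    ring
  · intro c _ hc
    simp only [clockShift]
    rw [if_neg (fun h' => hc (by rw [h']; ring))]
    simp
  · simp

theorem clockShift_zero_left (g : Exps) (b : ZMod n) :
    clockShift n g 0 b = if b = -((ofLex g).2 : ZMod n) then 1 else 0 := by
  simp only [clockShift, mul_zero, AddChar.map_zero_eq_one, one_mul]
  congr 1
  exact propext ⟨fun h => by linear_combination -h, fun h => by rw [h]; ring⟩

/-- Periodicity modulo `n` is what turns the series with exponents in `n ℤ²` into scalars for the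
algebra of monomials. -/
theorem clockShift_add_zsmul (g h : Exps) :
    clockShift n (g + (n : ℤ) • h) = clockShift n g := by
  ext a b
  simp [clockShift]

/-- The monomial `t^g` times the corresponding clock and shift matrix. -/
def qMonomial (g : Exps) : Matrix (ZMod n) (ZMod n) HahnField := fun a b =>
  HahnSeries.single g (clockShift n g a b)

theorem qMonomial_zero : qMonomial n 0 = 1 := by
  ext1 a b
  rw [qMonomial, clockShift_zero, Matrix.one_apply, Matrix.one_apply]
  split_ifs
  · rfl
  · simp

theorem qMonomial_mul (g h : Exps) : ∃ c : ℂ,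
    qMonomial n g * qMonomial n h = (HahnSeries.C c : HahnField) • qMonomial n (g + h) := by
  refine ⟨ZMod.stdAddChar (-((ofLex h).1 * (ofLex g).2 : ZMod n)), ?_⟩
  ext1 a b
  have := congrFun (congrFun (clockShift_mul n g h) a) b
  rw [Matrix.mul_apply] at this ⊢
  simp only [qMonomial, HahnSeries.single_mul_single, Matrix.smul_apply, smul_eq_mul,
    HahnSeries.C_apply, zero_add] at this ⊢
  rw [← this]
  exact (map_sum (HahnSeries.single.addMonoidHom (g + h)) _ _).symm

/-- The endomorphism of the Hahn series field that multiplies the exponents by `n`. -/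
def expScale : HahnField →+* HahnField :=
  HahnSeries.embDomainRingHom (zsmulAddGroupHom (n : ℤ))
    (fun a b h => by
      have hn : (0 : ℤ) < n := by exact_mod_cast Nat.pos_of_ne_zero (NeZero.ne n)
      exact le_antisymm ((zsmul_le_zsmul_iff_right hn).1 h.le)
        ((zsmul_le_zsmul_iff_right hn).1 h.ge))
    (fun a b => zsmul_le_zsmul_iff_right
      (by exact_mod_cast Nat.pos_of_ne_zero (NeZero.ne n)))

/-- The subfield of series whose exponents are divisible by `n`. -/
abbrev centerField : Subfield HahnField := (expScale n).fieldRange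

theorem C_mem_centerField (c : ℂ) : (HahnSeries.C c : HahnField) ∈ centerField n :=
  ⟨HahnSeries.C c, HahnSeries.embDomainRingHom_C⟩

theorem single_mem_centerField (g : Exps) (c : ℂ) :
    (HahnSeries.single ((n : ℤ) • g) c : HahnField) ∈ centerField n :=
  ⟨HahnSeries.single g c, HahnSeries.embDomain_single⟩

theorem exists_eq_zsmul_of_coeff_ne_zero {z : HahnField} (hz : z ∈ centerField n) {g : Exps}
    (hg : z.coeff g ≠ 0) : ∃ h : Exps, g = (n : ℤ) • h := by
  obtain ⟨x, rfl⟩ := hz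
  by_contra hcon
  refine hg (HahnSeries.embDomain_of_notMem_range ?_)
  rintro ⟨h, rfl⟩
  exact hcon ⟨h, rfl⟩

/-- The exponents of a basis of the matrix algebra. -/
def baseExp (j : Fin n × Fin n) : Exps := toLex ((j.1 : ℤ), (j.2 : ℤ))

theorem exists_baseExp (g : Exps) : ∃ j : Fin n × Fin n, ∃ h : Exps,
    g = baseExp n j + (n : ℤ) • h := by
  have hn : (0 : ℤ) < n := by exact_mod_cast Nat.pos_of_ne_zero (NeZero.ne n)
  have key : ∀ x : ℤ, ∃ j : Fin n, x = (j : ℤ) + n * (x / n) := by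
    intro x
    refine ⟨⟨(x % n).toNat, ?_⟩, ?_⟩
    · have := Int.emod_lt_of_pos x hn
      have := Int.emod_nonneg x hn.ne'
      omega
    · have := Int.emod_nonneg x hn.ne'
      have := Int.emod_add_mul_ediv x n
      simp only []
      omega
  obtain ⟨j, hj⟩ := key (ofLex g).1
  obtain ⟨k, hk⟩ := key (ofLex g).2
  refine ⟨(j, k), toLex ((ofLex g).1 / n, (ofLex g).2 / n), ?_⟩
  apply ofLex.injective
  ext
  · simpa [baseExp] using hj
  · simpa [baseExp] using hk

theorem qMonomial_mem_span (g : Exps) :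
    qMonomial n g ∈ Submodule.span (centerField n)
      (Set.range fun j => qMonomial n (baseExp n j)) := by
  obtain ⟨j, h, rfl⟩ := exists_baseExp n g
  have : qMonomial n (baseExp n j + (n : ℤ) • h) =
      (⟨_, single_mem_centerField n h 1⟩ : centerField n) • qMonomial n (baseExp n j) := by
    ext1 a b
    rw [Matrix.smul_apply, Subfield.smul_def]
    simp only [qMonomial, clockShift_add_zsmul, smul_eq_mul, HahnSeries.single_mul_single, one_mul]
    rw [add_comm]
  rw [this]
  exact Submodule.smul_mem _ _ (Submodule.subset_span ⟨j, rfl⟩)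

theorem span_qMonomial_mul {x y : Matrix (ZMod n) (ZMod n) HahnField}
    (hx : x ∈ Submodule.span (centerField n) (Set.range fun j => qMonomial n (baseExp n j)))
    (hy : y ∈ Submodule.span (centerField n) (Set.range fun j => qMonomial n (baseExp n j))) :
    x * y ∈ Submodule.span (centerField n) (Set.range fun j => qMonomial n (baseExp n j)) := by
  have := Submodule.mul_mem_mul hx hy
  rw [Submodule.span_mul_span] at this
  refine Submodule.span_le.2 ?_ this
  rintro _ ⟨_, ⟨i, rfl⟩, _, ⟨j, rfl⟩, rfl⟩
  obtain ⟨c, hc⟩ := qMonomial_mul n (baseExp n i) (baseExp n j)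
  simp only [hc]
  exact Submodule.smul_mem _ (⟨_, C_mem_centerField n c⟩ : centerField n)
    (qMonomial_mem_span n _)

/-- The algebra of quantum monomials, a division algebra of degree `n`. -/
def quantumAlgebra : Subalgebra (centerField n) (Matrix (ZMod n) (ZMod n) HahnField) :=
  (Submodule.span (centerField n) (Set.range fun j => qMonomial n (baseExp n j))).toSubalgebra
    (by rw [← qMonomial_zero]; exact qMonomial_mem_span n 0)
    (fun _ _ => span_qMonomial_mul n)

theorem mem_quantumAlgebra {x : Matrix (ZMod n) (ZMod n) HahnField} :
    x ∈ quantumAlgebra n ↔ ∃ c : Fin n × Fin n → centerField n,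
      ∑ j, c j • qMonomial n (baseExp n j) = x :=
  Submodule.mem_span_range_iff_exists_fun _

/-- Scalars in `centerField n` only involve exponents in `n ℤ²`, which do not change the clock and
shift matrix. So the coefficient of `t^g` in `x` is always a multiple of the single matrix
`clockShift n g`, and one series records all the multiples. -/
theorem exists_symbol {x : Matrix (ZMod n) (ZMod n) HahnField} (hx : x ∈ quantumAlgebra n) :
    ∃ f : HahnField, ∀ g a b, (x a b).coeff g = f.coeff g * clockShift n g a b := by
  obtain ⟨c, rfl⟩ := (mem_quantumAlgebra n).1 hx
  refine ⟨∑ j, (c j : HahnField) * HahnSeries.single (baseExp n j) 1, fun g a b => ?_⟩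
  have e : ∀ (z : HahnField) (h : Exps) (r : ℂ),
      (z * HahnSeries.single h r).coeff g = z.coeff (g - h) * r := fun z h r => by
    conv_lhs => rw [← sub_add_cancel g h]
    exact HahnSeries.coeff_mul_single_add
  rw [Matrix.sum_apply, HahnSeries.coeff_sum, HahnSeries.coeff_sum, Finset.sum_mul]
  refine Finset.sum_congr rfl fun j _ => ?_
  rw [Matrix.smul_apply, Subfield.smul_def, smul_eq_mul, qMonomial, e, e, mul_one]
  by_cases h0 : (c j : HahnField).coeff (g - baseExp n j) = 0
  · rw [h0, zero_mul, zero_mul]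
  · obtain ⟨h, hh⟩ := exists_eq_zsmul_of_coeff_ne_zero n (c j).2 h0
    rw [sub_eq_iff_eq_add'.1 hh, clockShift_add_zsmul]

instance : NoZeroDivisors (quantumAlgebra n) where
  eq_zero_or_eq_zero_of_mul_eq_zero := by
    rintro ⟨x, hx⟩ ⟨y, hy⟩ hxy
    obtain ⟨f, hf⟩ := exists_symbol n hx
    obtain ⟨f', hf'⟩ := exists_symbol n hy
    have hxy' : x * y = 0 := congrArg Subtype.val hxy
    by_contra! hne
    have ne : ∀ {z : Matrix (ZMod n) (ZMod n) HahnField} (hz : z ∈ quantumAlgebra n)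
        (f : HahnField), (⟨z, hz⟩ : quantumAlgebra n) ≠ 0 →
        (∀ g a b, (z a b).coeff g = f.coeff g * clockShift n g a b) → f ≠ 0 := by
      rintro z hz f hz0 hzf rfl
      refine hz0 (Subtype.ext ?_)
      ext a b g
      simp [hzf]
    have h1 := ne hx f hne.1 hf
    have h2 := ne hy f' hne.2 hf'
    -- In row 0 this column is where the clock and shift matrix of the lowest total exponent has
    -- entry 1, so the lowest coefficient of the product can be read off there.
    have e0 := congrFun (congrFun hxy' 0)
      (-((ofLex (f.order + f'.order)).2 : ZMod n))
    have e1 := congrArg (fun s : HahnField => s.coeff (f.order + f'.order)) e0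
    simp only [Matrix.mul_apply, HahnSeries.coeff_sum, Matrix.zero_apply,
      HahnSeries.coeff_zero] at e1
    have e2 : ∀ k, (x 0 k * y k (-((ofLex (f.order + f'.order)).2 : ZMod n))).coeff
        (f.order + f'.order) = (f.coeff f.order * f'.coeff f'.order) *
          (clockShift n f.order 0 k *
            clockShift n f'.order k (-((ofLex (f.order + f'.order)).2 : ZMod n))) := by
      intro k
      rw [coeff_mul_of_forall_lt, hf, hf']
      · ring
      · intro p hp
        rw [hf, HahnSeries.coeff_eq_zero_of_lt_order hp, zero_mul]
      · intro p hp
        rw [hf', HahnSeries.coeff_eq_zero_of_lt_order hp, zero_mul]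
    simp only [e2] at e1
    rw [← Finset.mul_sum, ← Matrix.mul_apply, clockShift_mul, Matrix.smul_apply,
      clockShift_zero_left, if_pos rfl, smul_eq_mul, mul_one] at e1
    refine mul_ne_zero (mul_ne_zero ?_ ?_) ?_ e1
    · exact HahnSeries.coeff_order_eq_zero.not.2 h1
    · exact HahnSeries.coeff_order_eq_zero.not.2 h2
    · intro h0
      have h3 := AddChar.map_add_eq_mul (ZMod.stdAddChar (N := n))
        (-((ofLex f'.order).1 * (ofLex f.order).2 : ZMod n))
        ((ofLex f'.order).1 * (ofLex f.order).2 : ZMod n)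
      rw [h0, zero_mul, neg_add_cancel, AddChar.map_zero_eq_one] at h3
      exact one_ne_zero h3

theorem linearIndependent_qMonomial :
    LinearIndependent HahnField fun j => qMonomial n (baseExp n j) := by
  rw [Fintype.linearIndependent_iff]
  intro c hc
  have key : ∀ k : Fin n, (fun j => c (j, k) * HahnSeries.single (baseExp n (j, k)) (1 : ℂ)) = 0 := by
    intro k
    -- Distinct `n`-th roots of unity: on a fixed off-diagonal the relation becomes a Vandermonde
    -- system in them.
    let ζ : Fin n → HahnField := fun a =>
      HahnSeries.C (ZMod.stdAddChar (((a : ℕ) : ZMod n)) : ℂ)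
    have hζ : Function.Injective ζ := by
      intro a b hab
      have h1 := ZMod.injective_stdAddChar (HahnSeries.C_injective hab)
      have h2 := (ZMod.natCast_eq_natCast_iff' _ _ _).1 h1
      rw [Nat.mod_eq_of_lt a.2, Nat.mod_eq_of_lt b.2] at h2
      exact Fin.ext h2
    refine Matrix.eq_zero_of_mulVec_eq_zero (Matrix.det_vandermonde_ne_zero_iff.2 hζ) ?_
    ext1 a
    -- The entry in row `a` and column `a - k` only sees monomials whose shift power is `k`.
    have h1 := congrFun (congrFun hc ((a : ℕ) : ZMod n)) (((a : ℕ) : ZMod n) - ((k : ℕ) : ZMod n))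
    rw [Matrix.sum_apply, Fintype.sum_prod_type_right, Finset.sum_eq_single k] at h1
    · rw [Matrix.mulVec, dotProduct]
      refine (Finset.sum_congr rfl fun j _ => ?_).trans h1
      rw [Matrix.smul_apply, smul_eq_mul, Matrix.vandermonde_apply, qMonomial]
      have : clockShift n (baseExp n (j, k)) ((a : ℕ) : ZMod n)
          (((a : ℕ) : ZMod n) - ((k : ℕ) : ZMod n)) =
          (ZMod.stdAddChar (((a : ℕ) : ZMod n)) : ℂ) ^ (j : ℕ) := by
        simp only [clockShift, baseExp, ofLex_toLex, Int.cast_natCast, sub_add_cancel, if_true,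
          mul_one]
        rw [← AddChar.map_nsmul_eq_pow, nsmul_eq_mul]
      rw [this]
      rw [← map_pow, HahnSeries.C_apply]
      rw [mul_left_comm, HahnSeries.single_mul_single, zero_add, mul_one]
    · intro l _ hl
      refine Finset.sum_eq_zero fun j _ => ?_
      rw [Matrix.smul_apply, qMonomial, clockShift, if_neg]
      · simp
      · intro h
        simp only [baseExp, ofLex_toLex, Int.cast_natCast] at h
        have h2 : ((l : ℕ) : ZMod n) = ((k : ℕ) : ZMod n) := by linear_combination -h
        have h2 := (ZMod.natCast_eq_natCast_iff' _ _ _).1 h2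
        rw [Nat.mod_eq_of_lt l.2, Nat.mod_eq_of_lt k.2] at h2
        exact hl (Fin.ext h2)
    · simp
  rintro ⟨j, k⟩
  have h1 := congrFun (key k) j
  simp only [Pi.zero_apply] at h1
  exact (mul_eq_zero.1 h1).resolve_right (HahnSeries.single_ne_zero one_ne_zero)

/-- For every `n` there is a division algebra `D` of dimension `n²` over a field `Z` containing
`ℂ` that is split by a field extension `F` of `Z`. -/
theorem exists_split_divisionRing :
    ∃ (F Z D : Type) (_ : Field F) (_ : Algebra ℂ F) (_ : Field Z) (_ : Algebra Z F)
      (_ : DivisionRing D) (_ : Algebra Z D) (φ : D →ₐ[Z] Matrix (ZMod n) (ZMod n) F)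
      (bD : Basis (Fin n × Fin n) Z D) (bF : Basis (Fin n × Fin n) F (Matrix (ZMod n) (ZMod n) F)),
      (∀ j, bF j = φ (bD j)) ∧ ∀ c : ℂ, ∃ z : Z, algebraMap Z F z = algebraMap ℂ F c := by
  have hli := linearIndependent_qMonomial n
  let bF : Basis (Fin n × Fin n) HahnField (Matrix (ZMod n) (ZMod n) HahnField) :=
    basisOfLinearIndependentOfCardEqFinrank hli
      (by simp [Module.finrank_matrix, ZMod.card])
  have hmem : ∀ j, qMonomial n (baseExp n j) ∈ quantumAlgebra n := fun j =>
    qMonomial_mem_span n _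
  have hliZ : LinearIndependent (centerField n)
      (fun j => (⟨_, hmem j⟩ : quantumAlgebra n)) := by
    refine LinearIndependent.of_comp (quantumAlgebra n).val.toLinearMap ?_
    refine hli.restrict_scalars ?_
    intro a b hab
    simpa [Subfield.smul_def] using hab
  let bD : Basis (Fin n × Fin n) (centerField n) (quantumAlgebra n) :=
    Basis.mk hliZ (by
      rintro ⟨x, hx⟩ -
      obtain ⟨c, hc⟩ := (mem_quantumAlgebra n).1 hx
      refine (Submodule.mem_span_range_iff_exists_fun _).2 ⟨c, Subtype.ext ?_⟩
      simpa using hc)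
  have : FiniteDimensional (centerField n) (quantumAlgebra n) := bD.finiteDimensional_of_finite
  have : IsDomain (quantumAlgebra n) := NoZeroDivisors.to_isDomain (quantumAlgebra n)
  refine ⟨HahnField, centerField n, quantumAlgebra n, inferInstance, inferInstance, inferInstance,
    inferInstance, divisionRingOfFiniteDimensional (centerField n) (quantumAlgebra n),
    inferInstanceAs (Algebra (centerField n) (quantumAlgebra n)), (quantumAlgebra n).val, bD, bF,
    fun j => ?_, fun c => ⟨⟨_, C_mem_centerField n c⟩, ?_⟩⟩
  · simp [bF, bD]
  · rw [HahnSeries.algebraMap_apply]; rfl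

end QuantumAlgebra

/-! ### Ranks of matrices and of linear maps -/

section Rank

theorem exists_eq_mul_rank {K : Type*} [Field K] {p q : Type*} [DecidableEq p]
    [Fintype q] [DecidableEq q] (M : Matrix p q K) :
    ∃ (P : Matrix p (Fin M.rank) K) (Q : Matrix (Fin M.rank) q K), M = P * Q := by
  let f := M.mulVecLin
  let e : LinearMap.range f ≃ₗ[K] (Fin M.rank → K) := (finBasis K (LinearMap.range f)).equivFun
  refine ⟨LinearMap.toMatrix' ((LinearMap.range f).subtype ∘ₗ e.symm.toLinearMap),
    LinearMap.toMatrix' (e.toLinearMap ∘ₗ f.rangeRestrict), ?_⟩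
  rw [← LinearMap.toMatrix'_comp]
  refine (LinearMap.toMatrix'_toLin' M).symm.trans (congrArg _ (LinearMap.ext fun x => ?_))
  simp [f]

variable {K L : Type*} [Field K] [Field L] [Algebra K L] {p q : Type*} [Fintype p] [Fintype q]

/-- Built from a retraction onto the range and a section over it. It turns a lower bound on rank
into an invertible minor-like product, which survives field extension and deformation. -/
theorem exists_mul_mul_eq_one [DecidableEq p] [DecidableEq q] (M : Matrix p q K) :
    ∃ (P : Matrix (Fin M.rank) p K) (Q : Matrix q (Fin M.rank) K), P * M * Q = 1 := by
  let f := M.mulVecLin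
  let e : LinearMap.range f ≃ₗ[K] (Fin M.rank → K) := (finBasis K (LinearMap.range f)).equivFun
  obtain ⟨g, hg⟩ := (LinearMap.range f).subtype.exists_leftInverse_of_injective
    (Submodule.ker_subtype _)
  obtain ⟨s, hs⟩ := f.rangeRestrict.exists_rightInverse_of_surjective
    (LinearMap.range_rangeRestrict f)
  refine ⟨LinearMap.toMatrix' (e.toLinearMap ∘ₗ g), LinearMap.toMatrix' (s ∘ₗ e.symm.toLinearMap),
    ?_⟩
  have hM : LinearMap.toMatrix' f = M := LinearMap.toMatrix'_toLin' M
  suffices h : LinearMap.toMatrix' (e.toLinearMap ∘ₗ g) * LinearMap.toMatrix' f *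
      LinearMap.toMatrix' (s ∘ₗ e.symm.toLinearMap) = 1 by rwa [hM] at h
  rw [← LinearMap.toMatrix'_comp, ← LinearMap.toMatrix'_comp, ← LinearMap.toMatrix'_id]
  congr 1
  refine LinearMap.ext fun x => ?_
  have h1 : f (s (e.symm x)) = e.symm x := congrArg Subtype.val (LinearMap.congr_fun hs (e.symm x))
  have h2 := LinearMap.congr_fun hg (e.symm x)
  simp only [LinearMap.comp_apply, LinearEquiv.coe_coe, Submodule.subtype_apply,
    LinearMap.id_apply] at h2 ⊢
  rw [h1, h2, LinearEquiv.apply_symm_apply]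

/-- A rank factorisation bounds the rank above and a factorisation `P * M * Q = 1` bounds it below;
both persist over the larger field. -/
theorem rank_map_algebraMap (M : Matrix p q K) : (M.map (algebraMap K L)).rank = M.rank := by
  classical
  apply le_antisymm
  · obtain ⟨P, Q, h⟩ := exists_eq_mul_rank M
    have : M.map (algebraMap K L) = P.map (algebraMap K L) * Q.map (algebraMap K L) := by
      rw [← Matrix.map_mul, ← h]
    rw [this]
    refine (Matrix.rank_mul_le_left _ _).trans ((Matrix.rank_le_card_width _).trans ?_)
    simp
  · obtain ⟨P, Q, h⟩ := exists_mul_mul_eq_one M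
    have h1 : P.map (algebraMap K L) * M.map (algebraMap K L) * Q.map (algebraMap K L) = 1 := by
      rw [← Matrix.map_mul, ← Matrix.map_mul, h, Matrix.map_one _ (map_zero _) (map_one _)]
    have h2 : (P.map (algebraMap K L) * M.map (algebraMap K L) * Q.map (algebraMap K L)).rank =
        M.rank := by rw [h1, Matrix.rank_one, Fintype.card_fin]
    rw [← h2]
    exact (Matrix.rank_mul_le_left _ _).trans (Matrix.rank_mul_le_right _ _)

/-- In a linear family of matrices the rank does not drop at suitable parameters from an infinite
subfield. -/
theorem exists_rank_le_of_infinite [Infinite K] {J : Type*} [Fintype J] (M : J → Matrix p q L)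
    (s : J → L) :
    ∃ s' : J → K, (∑ j, s j • M j).rank ≤ (∑ j, algebraMap K L (s' j) • M j).rank := by
  classical
  obtain ⟨P, Q, h⟩ := exists_mul_mul_eq_one (∑ j, s j • M j)
  let D : MvPolynomial J L := Matrix.det
    (∑ j, (MvPolynomial.X j : MvPolynomial J L) • (P * M j * Q).map MvPolynomial.C)
  have hD : ∀ t : J → L, MvPolynomial.eval t D = (P * (∑ j, t j • M j) * Q).det := by
    intro t
    rw [RingHom.map_det]
    congr 1
    rw [Matrix.mul_sum, Matrix.sum_mul]
    ext a b
    simp only [RingHom.mapMatrix_apply, Matrix.map_apply, Matrix.sum_apply, Matrix.smul_apply,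
      smul_eq_mul, map_sum, map_mul, MvPolynomial.eval_X, MvPolynomial.eval_C, Matrix.mul_smul,
      Matrix.smul_mul]
  have hD0 : D ≠ 0 := by
    intro h0
    have := hD s
    rw [h0, h, Matrix.det_one, map_zero] at this
    exact zero_ne_one this
  have : ∃ x ∈ Set.pi Set.univ (fun _ : J => Set.range (algebraMap K L)),
      MvPolynomial.eval x D ≠ 0 := by
    by_contra! hcon
    exact hD0 (MvPolynomial.funext_set (fun _ : J => Set.range (algebraMap K L))
      (fun _ => Set.infinite_range_of_injective (algebraMap K L).injective)
      fun x hx => by rw [hcon x hx, map_zero])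
  obtain ⟨x, hx, hx0⟩ := this
  choose s' hs' using fun j => hx j (Set.mem_univ j)
  refine ⟨s', ?_⟩
  rw [hD] at hx0
  have h2 := Matrix.rank_of_det_ne_zero hx0
  rw [Fintype.card_fin] at h2
  simp only [hs']
  rw [← h2]
  exact (Matrix.rank_mul_le_left _ _).trans (Matrix.rank_mul_le_right _ _)

theorem finrank_range_compLeft {V W : Type*} [AddCommGroup V] [Module K V] [AddCommGroup W]
    [Module K W] [FiniteDimensional K W] (f : V →ₗ[K] W) (σ : Type*) [Fintype σ] :
    finrank K (LinearMap.range (f.compLeft σ)) = Fintype.card σ * finrank K (LinearMap.range f) := by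
  have e : LinearMap.range (f.compLeft σ) ≃ₗ[K] (σ → LinearMap.range f) :=
    { toFun := fun x a => ⟨x.1 a, by obtain ⟨y, hy⟩ := x.2; exact ⟨y a, by rw [← hy]; rfl⟩⟩
      map_add' := fun _ _ => rfl
      map_smul' := fun _ _ => rfl
      invFun := fun x => ⟨fun a => x a, by
        choose y hy using fun a => (x a).2
        exact ⟨y, funext hy⟩⟩
      left_inv := fun _ => rfl
      right_inv := fun _ => rfl }
  rw [e.finrank_eq, finrank_pi_fintype]
  simp

theorem finrank_range_conj {V W V' W' : Type*} [AddCommGroup V] [Module K V] [AddCommGroup W]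
    [Module K W] [AddCommGroup V'] [Module K V'] [AddCommGroup W'] [Module K W']
    {f : V →ₗ[K] W} {g : V' →ₗ[K] W'} (e : V ≃ₗ[K] V') (e' : W ≃ₗ[K] W')
    (h : ∀ x, e' (f x) = g (e x)) :
    finrank K (LinearMap.range f) = finrank K (LinearMap.range g) := by
  have : LinearMap.range g = (LinearMap.range f).map e'.toLinearMap := by
    ext y
    constructor
    · rintro ⟨x, rfl⟩
      exact ⟨f (e.symm x), ⟨_, rfl⟩, by simp [h]⟩
    · rintro ⟨_, ⟨x, rfl⟩, rfl⟩
      exact ⟨e x, (h x).symm⟩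
  rw [this]
  exact (LinearEquiv.finrank_map_eq e' _).symm

end Rank

/-! ### The rank of a matrix over a split division algebra -/

section Split

variable {F Z D : Type*} [Field F] [Field Z] [Algebra Z F] [DivisionRing D] [Algebra Z D]
  {σ J : Type*} [Fintype σ] [DecidableEq σ] [Fintype J]

/-- Tuples of matrices, regarded as collections of their rows. -/
def rowsEquiv (F σ p : Type*) [Field F] : (p → Matrix σ σ F) ≃ₗ[F] (σ → p × σ → F) where
  toFun v a x := v x.1 a x.2
  map_add' _ _ := rfl
  map_smul' _ _ := rfl
  invFun w x a b := w a (x, b)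
  left_inv _ := rfl
  right_inv _ := rfl

theorem rowsEquiv_apply (F σ p : Type*) [Field F] (v : p → Matrix σ σ F) (a : σ) (x : p × σ) :
    rowsEquiv F σ p v a x = v x.1 a x.2 := rfl

/-- The range of right multiplication by `m` is a `D`-space, so its dimension over `Z` is a multiple
of `n²`, where `n` is the size of `σ`. After scalar extension to `F` the same map acts separately on
the `n` rows of each matrix, so that dimension is also `n` times the rank in question. Cancelling
`n` gives the divisibility. -/
theorem dvd_rank_of_split (φ : D →ₐ[Z] Matrix σ σ F) (bD : Basis J Z D)
    (bF : Basis J F (Matrix σ σ F)) (hb : ∀ j, bF j = φ (bD j)) {p q : Type*} [Fintype p]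
    [Fintype q] (m : Matrix p q D) :
    Fintype.card σ ∣ (Matrix.comp p q σ σ F (m.map φ)).rank := by
  classical
  let fD : (p → D) →ₗ[Z] (q → D) := m.vecMulLinear.restrictScalars Z
  let fF : (p → Matrix σ σ F) →ₗ[F] (q → Matrix σ σ F) :=
    (m.map φ).vecMulLinear.restrictScalars F
  let N := Matrix.comp p q σ σ F (m.map φ)
  -- The coordinates of `φ d` are those of `d`, so `fF` is the scalar extension of `fD`.
  have hrepr : ∀ d k, bF.repr (φ d) k = algebraMap Z F (bD.repr d k) := by
    intro d k
    conv_lhs => rw [← bD.sum_repr d]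
    simp only [map_sum, map_smul, ← hb]
    rw [Finsupp.finsetSum_apply, Finset.sum_eq_single k]
    · rw [← algebraMap_smul F, map_smul, Basis.repr_self]
      simp [Algebra.algebraMap_eq_smul_one]
    · intro j _ hj
      rw [← algebraMap_smul F, map_smul, Basis.repr_self]
      simp [hj]
    · simp
  have h1 : finrank F (LinearMap.range fF) = Fintype.card σ * N.rank := by
    rw [← Matrix.rank_transpose, Matrix.rank, Matrix.mulVecLin_transpose,
      ← finrank_range_compLeft]
    refine finrank_range_conj (rowsEquiv F σ p) (rowsEquiv F σ q) fun v => ?_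
    funext a y
    simp only [rowsEquiv_apply, fF, N, LinearMap.restrictScalars_apply, Matrix.vecMulLinear_apply,
      LinearMap.compLeft_apply, Function.comp_apply, Matrix.vecMul, dotProduct, Matrix.sum_apply,
      Matrix.mul_apply, Fintype.sum_prod_type, Matrix.map_apply, Matrix.comp_apply]
  have h2 : finrank F (LinearMap.range fF) = finrank Z (LinearMap.range fD) := by
    have e : LinearMap.toMatrix (Pi.basis fun _ : p => bF) (Pi.basis fun _ : q => bF) fF =
        (LinearMap.toMatrix (Pi.basis fun _ : p => bD) (Pi.basis fun _ : q => bD) fD).map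
          (algebraMap Z F) := by
      ext ⟨y, k⟩ ⟨x, j⟩
      rw [Matrix.map_apply, LinearMap.toMatrix_apply, LinearMap.toMatrix_apply, Pi.basis_repr,
        Pi.basis_repr, ← hrepr, Pi.basis_apply, Pi.basis_apply]
      simp [fF, fD, Matrix.single_vecMul, hb]
    have r1 := Matrix.rank_eq_finrank_range_toLin (LinearMap.toMatrix (Pi.basis fun _ : p => bF)
      (Pi.basis fun _ : q => bF) fF) (Pi.basis fun _ : q => bF) (Pi.basis fun _ : p => bF)
    have r2 := Matrix.rank_eq_finrank_range_toLin (LinearMap.toMatrix (Pi.basis fun _ : p => bD)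
      (Pi.basis fun _ : q => bD) fD) (Pi.basis fun _ : q => bD) (Pi.basis fun _ : p => bD)
    rw [Matrix.toLin_toMatrix] at r1 r2
    rw [← r1, ← r2, e, rank_map_algebraMap]
  have h3 : finrank Z (LinearMap.range fD) =
      finrank Z D * finrank D (LinearMap.range m.vecMulLinear) :=
    (finrank_mul_finrank Z D (LinearMap.range m.vecMulLinear)).symm
  have h4 : finrank Z D = Fintype.card σ * Fintype.card σ := by
    rw [finrank_eq_card_basis bD, ← finrank_eq_card_basis bF, finrank_matrix]
    simp
  rcases Nat.eq_zero_or_pos (Fintype.card σ) with h0 | hpos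
  · have : IsEmpty σ := Fintype.card_eq_zero_iff.1 h0
    have := Matrix.rank_le_card_width N
    simp at this
    rw [show (Matrix.comp p q σ σ F (m.map φ)).rank = 0 from this]
    exact dvd_zero _
  · refine ⟨finrank D (LinearMap.range m.vecMulLinear), Nat.eq_of_mul_eq_mul_left hpos ?_⟩
    rw [← mul_assoc, ← h4, ← h3, ← h2, h1]

end Split

/-! ### The generic rank of a blow-up is divisible by its size -/

section Regularity

variable {p q κ : Type*} [Fintype p] [Fintype q] [Fintype κ]

/-- The matrix `∑ i, b i ⊗ T i`. -/
def blowUp (F : Type*) [Field F] [Algebra ℂ F] {p q κ σ : Type*} [Fintype κ]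
    (b : κ → Matrix p q ℂ) (T : κ → Matrix σ σ F) : Matrix (p × σ) (q × σ) F :=
  Matrix.of fun x y => ∑ i, algebraMap ℂ F (b i x.1 y.1) * T i x.2 y.2

theorem blowUp_map (F : Type*) [Field F] [Algebra ℂ F] {p q κ σ : Type*} [Fintype κ]
    (b : κ → Matrix p q ℂ) (T : κ → Matrix σ σ ℂ) :
    blowUp F b (fun i => (T i).map (algebraMap ℂ F)) = (blowUp ℂ b T).map (algebraMap ℂ F) := by
  ext x y
  simp [blowUp]

/-- The blow-up depends linearly on the coordinates of the `T i` in `β`, so these may be replaced by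
complex numbers without losing rank. -/
theorem exists_rank_blowUp_le (F : Type*) [Field F] [Algebra ℂ F] {σ J : Type*} [Fintype σ]
    [Fintype J] (b : κ → Matrix p q ℂ) (β : Basis J F (Matrix σ σ F)) (T : κ → Matrix σ σ F) :
    ∃ s : κ → J → ℂ, (blowUp F b T).rank ≤
      (blowUp F b fun i => ∑ j, algebraMap ℂ F (s i j) • β j).rank := by
  have e : ∀ c : κ → J → F, blowUp F b (fun i => ∑ j, c i j • β j) =
      ∑ x : κ × J, c x.1 x.2 • (Matrix.of fun a a' => algebraMap ℂ F (b x.1 a.1 a'.1) * β x.2 a.2 a'.2 :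
        Matrix (p × σ) (q × σ) F) := by
    intro c
    ext a a'
    simp only [blowUp, Matrix.of_apply, Matrix.sum_apply, Matrix.smul_apply, smul_eq_mul, Fintype.sum_prod_type,
      Finset.mul_sum]
    exact Finset.sum_congr rfl fun i _ => Finset.sum_congr rfl fun j _ => by ring
  obtain ⟨s, hs⟩ := exists_rank_le_of_infinite (K := ℂ)
    (fun x : κ × J => (Matrix.of fun a a' => algebraMap ℂ F (b x.1 a.1 a'.1) * β x.2 a.2 a'.2 :
        Matrix (p × σ) (q × σ) F)) (fun x => β.repr (T x.1) x.2)
  refine ⟨fun i j => s (i, j), ?_⟩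
  rw [e]
  refine le_trans (le_of_eq ?_) hs
  rw [← e fun i j => β.repr (T i) j]
  simp only [β.sum_repr]

/-- The regularity lemma: the maximal rank of the matrices `∑ i, b i ⊗ T i` with `T i` of size `n`
is a multiple of `n`. -/
theorem exists_max_rank_blowUp_eq_mul (b : κ → Matrix p q ℂ) (n : ℕ) [NeZero n] :
    ∃ k, ∃ T₀ : κ → Matrix (ZMod n) (ZMod n) ℂ, (blowUp ℂ b T₀).rank = n * k ∧
      ∀ T : κ → Matrix (ZMod n) (ZMod n) ℂ, (blowUp ℂ b T).rank ≤ n * k := by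
  classical
  let S : Set ℕ := Set.range fun T : κ → Matrix (ZMod n) (ZMod n) ℂ => (blowUp ℂ b T).rank
  have hS : BddAbove S := ⟨Fintype.card (q × ZMod n), by
    rintro _ ⟨T, rfl⟩
    exact Matrix.rank_le_card_width _⟩
  obtain ⟨T₀, hT₀⟩ : sSup S ∈ S := Nat.sSup_mem ⟨_, 0, rfl⟩ hS
  have hmax : ∀ T : κ → Matrix (ZMod n) (ZMod n) ℂ,
      (blowUp ℂ b T).rank ≤ (blowUp ℂ b T₀).rank := fun T =>
    (le_csSup hS ⟨T, rfl⟩).trans_eq hT₀.symm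
  obtain ⟨F, Z, D, _, _, _, _, _, _, φ, bD, bF, hb, hZ⟩ := exists_split_divisionRing n
  choose z hz using hZ
  -- Two specialisations squeeze the rank: first to complex coordinates in the basis coming from
  -- `D`, then to complex matrices, whose rank is at most that of `T₀`. The middle matrix, with
  -- entries in `D`, thus has exactly the maximal rank.
  obtain ⟨s, hs⟩ := exists_rank_blowUp_le F b bF fun i => (T₀ i).map (algebraMap ℂ F)
  rw [blowUp_map, rank_map_algebraMap] at hs
  obtain ⟨s', hs'⟩ := exists_rank_blowUp_le F b (Matrix.stdBasis F (ZMod n) (ZMod n))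
    fun i => ∑ j, algebraMap ℂ F (s i j) • bF j
  have e' : (fun i => ∑ j, algebraMap ℂ F (s' i j) • Matrix.stdBasis F (ZMod n) (ZMod n) j) =
      fun i => (Matrix.of fun a c => s' i (a, c)).map (algebraMap ℂ F) := by
    funext i
    ext a c
    rw [Matrix.sum_apply, Finset.sum_eq_single (a, c)]
    · simp [Matrix.stdBasis_eq_single]
    · rintro ⟨a', c'⟩ - hne
      rw [Matrix.stdBasis_eq_single, Matrix.smul_apply, Matrix.single_apply_of_ne, smul_zero]
      rintro ⟨rfl, rfl⟩
      exact hne rfl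
    · simp
  rw [e', blowUp_map, rank_map_algebraMap] at hs'
  have heq := le_antisymm hs (hs'.trans (hmax _))
  have hdvd : n ∣ (blowUp F b fun i => ∑ j, algebraMap ℂ F (s i j) • bF j).rank := by
    -- Complex constants lift to `Z`, so the middle matrix is the image of a matrix over `D`.
    have h := dvd_rank_of_split φ bD bF hb
      (Matrix.of fun (x : p) (y : q) => ∑ i, ∑ j, (z (b i x y) * z (s i j)) • bD j)
    rw [ZMod.card] at h
    convert h using 2
    ext ⟨x, a⟩ ⟨y, c⟩
    simp only [blowUp, Matrix.of_apply, Matrix.comp_apply, Matrix.map_apply, map_sum, map_smul, ← hb,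
      Matrix.sum_apply, Finset.mul_sum]
    refine Finset.sum_congr rfl fun i _ => Finset.sum_congr rfl fun j _ => ?_
    rw [← algebraMap_smul F (z _ * z _) (bF j), map_mul, hz, hz, Matrix.smul_apply, Matrix.smul_apply, smul_eq_mul,
      smul_eq_mul, mul_assoc]
  rw [← heq] at hdvd
  obtain ⟨k, hk⟩ := hdvd
  exact ⟨k, T₀, hk, fun T => hk ▸ hmax T⟩

end Regularity

/-! ### Shrunk subspaces of spaces of linear maps -/

section Wong

variable {V W : Type*} [AddCommGroup V] [Module ℂ V] [AddCommGroup W] [Module ℂ W]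

/-- The linear map between powers of `V` and `W` with a given matrix of linear maps. -/
def blockMap {σ : Type*} [Fintype σ] (M : σ → σ → (V →ₗ[ℂ] W)) : (σ → V) →ₗ[ℂ] (σ → W) :=
  LinearMap.pi fun a => ∑ b, M a b ∘ₗ LinearMap.proj b

theorem blockMap_apply {σ : Type*} [Fintype σ] (M : σ → σ → (V →ₗ[ℂ] W)) (x : σ → V) (a : σ) :
    blockMap M x a = ∑ b, M a b (x b) := by
  simp [blockMap, LinearMap.sum_apply]

/-- Compressed to the range of `f`, the map `f - t • g` becomes `1 - t k`, which is injective unless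
`t⁻¹` is one of the finitely many eigenvalues of `k`. -/
theorem exists_finrank_range_le_sub_smul [FiniteDimensional ℂ W] (f g : V →ₗ[ℂ] W) :
    ∃ t : ℂ, t ≠ 0 ∧
      finrank ℂ (LinearMap.range f) ≤ finrank ℂ (LinearMap.range (f - t • g)) := by
  obtain ⟨p, hp⟩ := (LinearMap.range f).subtype.exists_leftInverse_of_injective
    (Submodule.ker_subtype _)
  obtain ⟨s, hs⟩ := f.rangeRestrict.exists_rightInverse_of_surjective
    (LinearMap.range_rangeRestrict f)
  let k : End ℂ (LinearMap.range f) := p ∘ₗ g ∘ₗ s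
  obtain ⟨c, hc⟩ := ((Module.End.finite_hasEigenvalue k).union (Set.finite_singleton 0)).exists_notMem
  have hc0 : c ≠ 0 := fun h => hc (Or.inr h)
  have hck : ¬ k.HasEigenvalue c := fun h => hc (Or.inl h)
  refine ⟨c⁻¹, inv_ne_zero hc0, ?_⟩
  have hinj : Function.Injective (p ∘ₗ (f - c⁻¹ • g) ∘ₗ s) := by
    rw [← LinearMap.ker_eq_bot, LinearMap.ker_eq_bot']
    intro x hx
    have h1 : p (f (s x)) = x := by
      have h2 : f (s x) = x := congrArg Subtype.val (LinearMap.congr_fun hs x)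
      rw [h2]
      exact LinearMap.congr_fun hp x
    simp only [LinearMap.comp_apply, LinearMap.sub_apply, LinearMap.smul_apply, map_sub, map_smul,
      h1, sub_eq_zero] at hx
    by_contra hx0
    refine hck (Module.End.hasEigenvalue_of_hasEigenvector (x := x)
      ⟨Module.End.mem_eigenspace_iff.2 ?_, hx0⟩)
    conv_rhs => rw [hx]
    rw [smul_inv_smul₀ hc0]
    rfl
  rw [← LinearMap.finrank_range_of_inj hinj, LinearMap.range_comp]
  refine (Submodule.finrank_map_le _ _).trans (Submodule.finrank_mono ?_)
  exact LinearMap.range_comp_le_range _ _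

/-- Adjoining `w` as an extra column raises the rank of `f`. That larger rank persists for some
nonzero `t`, where the extra column is redundant. -/
theorem exists_finrank_range_lt_sub_smul [FiniteDimensional ℂ W] (f g : V →ₗ[ℂ] W) {w : W}
    (hw : w ∉ LinearMap.range f) (h : ∀ t : ℂ, t ≠ 0 → w ∈ LinearMap.range (f - t • g)) :
    ∃ t : ℂ, finrank ℂ (LinearMap.range f) < finrank ℂ (LinearMap.range (f - t • g)) := by
  let f' : (V × ℂ) →ₗ[ℂ] W := f.coprod (LinearMap.toSpanSingleton ℂ W w)
  obtain ⟨t, ht, hle⟩ := exists_finrank_range_le_sub_smul f' (g ∘ₗ LinearMap.fst ℂ V ℂ)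
  refine ⟨t, lt_of_lt_of_le ?_ (hle.trans (Submodule.finrank_mono ?_))⟩
  · refine Submodule.finrank_lt_finrank_of_lt (lt_of_le_of_ne ?_ ?_)
    · rintro _ ⟨x, rfl⟩
      exact ⟨(x, 0), by simp [f']⟩
    · intro heq
      exact hw (heq ▸ ⟨(0, 1), by simp [f']⟩)
  · rintro _ ⟨⟨x, s⟩, rfl⟩
    have : (f' - t • g ∘ₗ LinearMap.fst ℂ V ℂ) (x, s) = (f - t • g) x + s • w := by
      simp [f']
      abel
    rw [this]
    exact add_mem ⟨x, rfl⟩ (Submodule.smul_mem _ _ (h t ht))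

/-- The vectors reached from the kernel of `d` by alternately applying a map in `B` and taking
a preimage under `d`. -/
inductive WongReach (B : Submodule ℂ (V →ₗ[ℂ] W)) (d : V →ₗ[ℂ] W) : V → Prop
  | ker (v : V) (hv : d v = 0) : WongReach B d v
  | step (v v' : V) (c : V →ₗ[ℂ] W) (hc : c ∈ B) (hv : WongReach B d v) (h : d v' = c v) :
      WongReach B d v'

/-- Extend a block matrix by a row whose only nonzero entry is `c`, in column `j`, and by a zero
column. -/
def extendBlock {σ : Type*} [DecidableEq σ] (C : σ → σ → (V →ₗ[ℂ] W)) (j : σ) (c : V →ₗ[ℂ] W) :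
    Option σ → Option σ → (V →ₗ[ℂ] W)
  | none, none => 0
  | none, some b => if b = j then c else 0
  | some _, none => 0
  | some a, some b => C a b

theorem extendBlock_mem {σ : Type*} [DecidableEq σ] {B : Submodule ℂ (V →ₗ[ℂ] W)}
    {C : σ → σ → (V →ₗ[ℂ] W)} (hC : ∀ a b, C a b ∈ B) (j : σ) {c : V →ₗ[ℂ] W} (hc : c ∈ B) :
    ∀ a b, extendBlock C j c a b ∈ B
  | none, none => B.zero_mem
  | none, some b => by
    rw [extendBlock]
    split_ifs
    · exact hc
    · exact B.zero_mem
  | some _, none => B.zero_mem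
  | some a, some b => hC a b

theorem sum_extendBlock_none {σ : Type*} [Fintype σ] [DecidableEq σ] (C : σ → σ → (V →ₗ[ℂ] W))
    (j : σ) (c : V →ₗ[ℂ] W) (x : Option σ → V) :
    ∑ b, extendBlock C j c none b (x b) = c (x (some j)) := by
  rw [Fintype.sum_option, Finset.sum_eq_single j]
  · simp [extendBlock]
  · intro b _ hb
    simp [extendBlock, hb]
  · simp

theorem sum_extendBlock_some {σ : Type*} [Fintype σ] [DecidableEq σ] (C : σ → σ → (V →ₗ[ℂ] W))
    (j : σ) (c : V →ₗ[ℂ] W) (x : Option σ → V) (a : σ) :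
    ∑ b, extendBlock C j c (some a) b (x b) = ∑ b, C a b (x (some b)) := by
  simp [Fintype.sum_option, extendBlock]

/-- A chain of Wong steps is encoded in one block matrix `C`, one index per step: an element of the
kernel of the block map `d - t C` traverses the chain, gaining a factor `t` at each step, and ends
in a multiple of `v`. -/
theorem WongReach.exists_deformation {B : Submodule ℂ (V →ₗ[ℂ] W)} {d : V →ₗ[ℂ] W} {v : V}
    (hv : WongReach B d v) :
    ∃ (σ : Type) (_ : Fintype σ) (C : σ → σ → (V →ₗ[ℂ] W)) (j : σ) (s : ℕ),
      (∀ a b, C a b ∈ B) ∧ ∀ t : ℂ, ∃ x : σ → V,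
        (∀ a, d (x a) = t • ∑ b, C a b (x b)) ∧ x j = t ^ s • v := by
  induction hv with
  | ker v hv =>
    exact ⟨Unit, inferInstance, 0, (), 0, fun _ _ => B.zero_mem, fun t =>
      ⟨fun _ => v, fun _ => by simp [hv], by simp⟩⟩
  | step v v' c hc hv h ih =>
    obtain ⟨σ, _, C, j, s, hC, hx⟩ := ih
    classical
    refine ⟨Option σ, inferInstance, extendBlock C j c, none, s + 1, extendBlock_mem hC j hc,
      fun t => ?_⟩
    obtain ⟨x, hx1, hx2⟩ := hx t
    refine ⟨fun a => a.elim (t ^ (s + 1) • v') x, ?_, rfl⟩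
    rintro (_ | a)
    · rw [sum_extendBlock_none]
      simp only [Option.elim_none, Option.elim_some, hx2, map_smul, h, smul_smul, pow_succ']
    · rw [sum_extendBlock_some]
      exact hx1 a

/-- If `c v` escaped the range of `d`, appending `c` as a last row to the encoded chain would put
the vector `(c v, 0)` into the range of `d - t C` for every `t ≠ 0`, though not for `t = 0`. The
rank of some blow-up would then exceed the assumed bound. -/
theorem WongReach.mem_range [FiniteDimensional ℂ W] {B : Submodule ℂ (V →ₗ[ℂ] W)} {d : V →ₗ[ℂ] W}
    (hd : d ∈ B)
    (hmax : ∀ (σ : Type) [Fintype σ] (M : σ → σ → (V →ₗ[ℂ] W)), (∀ a b, M a b ∈ B) →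
      finrank ℂ (LinearMap.range (blockMap M)) ≤ Fintype.card σ * finrank ℂ (LinearMap.range d))
    {v : V} (hv : WongReach B d v) {c : V →ₗ[ℂ] W} (hc : c ∈ B) : c v ∈ LinearMap.range d := by
  classical
  by_contra hcv
  obtain ⟨σ, _, C, j, s, hC, hx⟩ := hv.exists_deformation
  let w : Option σ → W := fun a => a.elim (c v) 0
  obtain ⟨t, ht⟩ := exists_finrank_range_lt_sub_smul (d.compLeft (Option σ)) (blockMap (extendBlock C j c)) (w := w)
    (by
      rintro ⟨x, hx⟩
      exact hcv ⟨x none, congrFun hx none⟩)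
    (by
      intro t ht
      obtain ⟨x, hx1, hx2⟩ := hx t
      -- The value at the deformed vector is `-t ^ (s + 1)` times `w`: `t ^ s` from the chain and
      -- `-t` from the last row.
      have h0 : (-t ^ (s + 1)) ≠ 0 := neg_ne_zero.2 (pow_ne_zero _ ht)
      rw [← Submodule.smul_mem_iff _ h0]
      refine ⟨fun a => a.elim 0 x, ?_⟩
      funext a
      simp only [LinearMap.sub_apply, LinearMap.smul_apply, Pi.sub_apply, Pi.smul_apply,
        LinearMap.compLeft_apply, Function.comp_apply, blockMap_apply]
      rcases a with (_ | a)
      · rw [sum_extendBlock_none]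
        simp only [Option.elim_none, Option.elim_some, map_zero, zero_sub, hx2, map_smul, smul_smul,
          neg_smul, pow_succ', w]
      · rw [sum_extendBlock_some]
        simp [w, hx1])
  rw [finrank_range_compLeft] at ht
  have hM : d.compLeft (Option σ) - t • blockMap (extendBlock C j c) =
      blockMap fun a b => (if a = b then d else 0) - t • extendBlock C j c a b := by
    refine LinearMap.ext fun x => funext fun a => ?_
    simp only [blockMap_apply, LinearMap.sub_apply, LinearMap.smul_apply, Pi.sub_apply,
      Pi.smul_apply, LinearMap.compLeft_apply, Function.comp_apply, Finset.sum_sub_distrib,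
      Finset.smul_sum]
    rw [Finset.sum_eq_single (f := fun b => (if a = b then d else 0) (x b)) a, if_pos rfl]
    · intro b _ hb
      rw [if_neg hb.symm, LinearMap.zero_apply]
    · simp
  rw [hM] at ht
  refine absurd (hmax (Option σ) _ fun a b => ?_) (not_le.2 ht)
  refine sub_mem ?_ (B.smul_mem _ (extendBlock_mem hC j hc a b))
  split_ifs
  · exact hd
  · exact B.zero_mem

/-- If the rank of `d` cannot be increased in blow-ups of `B`, then there is a subspace `U`
containing `ker d` that is mapped into `d U` by every element of `B`. -/
theorem exists_map_le_map [FiniteDimensional ℂ W] {B : Submodule ℂ (V →ₗ[ℂ] W)} {d : V →ₗ[ℂ] W}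
    (hd : d ∈ B)
    (hmax : ∀ (σ : Type) [Fintype σ] (M : σ → σ → (V →ₗ[ℂ] W)), (∀ a b, M a b ∈ B) →
      finrank ℂ (LinearMap.range (blockMap M)) ≤ Fintype.card σ * finrank ℂ (LinearMap.range d)) :
    ∃ U : Submodule ℂ V, LinearMap.ker d ≤ U ∧ ∀ c ∈ B, U.map c ≤ U.map d := by
  refine ⟨Submodule.span ℂ {v | WongReach B d v}, fun v hv => Submodule.subset_span (.ker v hv),
    fun c hc => ?_⟩
  rw [Submodule.map_span_le]
  intro v hv
  obtain ⟨v', hv'⟩ := WongReach.mem_range hd hmax hv hc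
  exact ⟨v', Submodule.subset_span (WongReach.step v v' c hc hv hv'), hv'⟩

end Wong

/-! ### The non-commutative rank of a space of linear maps -/

section NoncommutativeRank

variable {V W : Type*} [AddCommGroup V] [Module ℂ V] [AddCommGroup W] [Module ℂ W]

theorem finrank_range_blockMap_reindex {σ τ : Type*} [Fintype σ] [Fintype τ] (e : σ ≃ τ)
    (M : σ → σ → (V →ₗ[ℂ] W)) :
    finrank ℂ (LinearMap.range (blockMap fun a b => M (e.symm a) (e.symm b))) =
      finrank ℂ (LinearMap.range (blockMap M)) := by
  refine finrank_range_conj (LinearEquiv.funCongrLeft ℂ V e) (LinearEquiv.funCongrLeft ℂ W e)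
    fun x => funext fun a => ?_
  simp only [LinearEquiv.funCongrLeft_apply, LinearMap.funLeft_apply, blockMap_apply,
    Equiv.symm_apply_apply]
  exact (Equiv.sum_comp e fun b => M a (e.symm b) (x b)).symm.trans (by simp)

/-- A blow-up of a blow-up is again a blow-up, so rank bounds for `B` carry over to its matrix
spaces. -/
theorem finrank_range_blockMap_blockMap {σ τ : Type*} [Fintype σ] [Fintype τ]
    (M : τ → τ → σ → σ → (V →ₗ[ℂ] W)) :
    finrank ℂ (LinearMap.range (blockMap fun s t => blockMap (M s t))) =
      finrank ℂ (LinearMap.range (blockMap fun x y : τ × σ => M x.1 y.1 x.2 y.2)) := by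
  refine finrank_range_conj (LinearEquiv.curry ℂ V τ σ).symm (LinearEquiv.curry ℂ W τ σ).symm
    fun x => funext fun a => ?_
  rw [LinearEquiv.coe_curry_symm, LinearEquiv.coe_curry_symm]
  simp only [Function.uncurry, blockMap_apply, Fintype.sum_prod_type, Finset.sum_apply]

theorem finrank_map_add_finrank_ker [FiniteDimensional ℂ V] {d : V →ₗ[ℂ] W} {U : Submodule ℂ V}
    (h : LinearMap.ker d ≤ U) :
    finrank ℂ (U.map d) + finrank ℂ (LinearMap.ker d) = finrank ℂ U := by
  have h1 := LinearMap.finrank_range_add_finrank_ker (d.domRestrict U)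
  rw [LinearMap.range_domRestrict] at h1
  rw [← h1, LinearMap.ker_domRestrict]
  congr 1
  exact (Submodule.comapSubtypeEquivOfLe h).finrank_eq.symm

theorem exists_flattenEquiv {X : Type*} [AddCommGroup X] [Module ℂ X] (σ : Type*) {κ : Type*}
    [Finite κ] (bX : Basis κ ℂ X) :
    ∃ e : (σ → X) ≃ₗ[ℂ] (κ × σ → ℂ), ∀ v y, e v y = bX.repr (v y.2) y.1 := by
  have := Fintype.ofFinite κ
  exact ⟨(LinearEquiv.piCongrRight fun _ => bX.equivFun).trans
    ((LinearEquiv.curry ℂ ℂ σ κ).symm.trans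
      (LinearEquiv.funCongrLeft ℂ ℂ (Equiv.prodComm κ σ))), fun _ _ => rfl⟩

variable [FiniteDimensional ℂ V] [FiniteDimensional ℂ W]

theorem exists_max_rank_blockMap (B : Submodule ℂ (V →ₗ[ℂ] W)) (n : ℕ) [NeZero n] :
    ∃ k, ∃ M₀ : ZMod n → ZMod n → (V →ₗ[ℂ] W), (∀ a b, M₀ a b ∈ B) ∧
      finrank ℂ (LinearMap.range (blockMap M₀)) = n * k ∧
      ∀ M : ZMod n → ZMod n → (V →ₗ[ℂ] W), (∀ a b, M a b ∈ B) →
        finrank ℂ (LinearMap.range (blockMap M)) ≤ n * k := by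
  classical
  let β := finBasis ℂ B
  let bV := finBasis ℂ V
  let bW := finBasis ℂ W
  let b := fun i => LinearMap.toMatrix bV bW (β i : V →ₗ[ℂ] W)
  let lin := fun (T : Fin (finrank ℂ B) → Matrix (ZMod n) (ZMod n) ℂ) (a c : ZMod n) =>
    ∑ i, T i a c • (β i : V →ₗ[ℂ] W)
  have hmem : ∀ T a c, lin T a c ∈ B := fun T a c =>
    Submodule.sum_mem _ fun i _ => B.smul_mem _ (β i).2
  have hlin : ∀ T, finrank ℂ (LinearMap.range (blockMap (lin T))) = (blowUp ℂ b T).rank := by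
    intro T
    obtain ⟨eV, heV⟩ := exists_flattenEquiv (ZMod n) bV
    obtain ⟨eW, heW⟩ := exists_flattenEquiv (ZMod n) bW
    refine finrank_range_conj eV eW fun v => funext fun x => ?_
    rw [heW, blockMap_apply]
    simp only [lin, LinearMap.sum_apply, LinearMap.smul_apply, map_sum, map_smul,
      Finsupp.finsetSum_apply, Finsupp.smul_apply, smul_eq_mul, Matrix.mulVecLin_apply,
      Matrix.mulVec, dotProduct, blowUp, Matrix.of_apply, Fintype.sum_prod_type_right, heV,
      Algebra.algebraMap_self, RingHom.id_apply, Finset.sum_mul]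
    refine Finset.sum_congr rfl fun c _ => ?_
    rw [Finset.sum_comm]
    refine Finset.sum_congr rfl fun i _ => ?_
    have h := congrFun (LinearMap.toMatrix_mulVec_repr bV bW (β i : V →ₗ[ℂ] W) (v c)) x.1
    rw [← h, Matrix.mulVec, dotProduct, Finset.mul_sum]
    exact Finset.sum_congr rfl fun y _ => by ring
  obtain ⟨k, T₀, hT₀, hmax⟩ := exists_max_rank_blowUp_eq_mul b n
  refine ⟨k, lin T₀, hmem T₀, (hlin T₀).trans hT₀, fun M hM => ?_⟩
  have : M = lin fun i => Matrix.of fun a c => β.repr ⟨M a c, hM a c⟩ i := by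
    funext a c
    have h := congrArg Subtype.val (β.sum_repr ⟨M a c, hM a c⟩)
    rw [Submodule.coe_sum] at h
    exact h.symm
  rw [this, hlin]
  exact hmax _

/-- By regularity the maximal rank divided by the size is an integer, bounded by `dim W`. A supremum
of bounded integers is attained, so one size is optimal among all. -/
theorem exists_max_rank_ratio (B : Submodule ℂ (V →ₗ[ℂ] W)) :
    ∃ (n : ℕ) (_ : NeZero n) (k : ℕ) (M₀ : ZMod n → ZMod n → (V →ₗ[ℂ] W)), (∀ a b, M₀ a b ∈ B) ∧
      finrank ℂ (LinearMap.range (blockMap M₀)) = n * k ∧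
      ∀ (σ : Type) [Fintype σ] (M : σ → σ → (V →ₗ[ℂ] W)), (∀ a b, M a b ∈ B) →
        finrank ℂ (LinearMap.range (blockMap M)) ≤ Fintype.card σ * k := by
  -- The shift to `n + 1` keeps the size nonzero.
  choose K M₀ hM₀ hK hmax using fun n : ℕ => exists_max_rank_blockMap B (n + 1)
  have hbdd : BddAbove (Set.range K) := by
    refine ⟨finrank ℂ W, ?_⟩
    rintro _ ⟨n, rfl⟩
    have h := Submodule.finrank_le (LinearMap.range (blockMap (M₀ n)))
    rw [hK, finrank_pi_fintype, Finset.sum_const, Finset.card_univ, ZMod.card, smul_eq_mul] at h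
    exact Nat.le_of_mul_le_mul_left h n.succ_pos
  obtain ⟨n, hn⟩ := Nat.sSup_mem (Set.range_nonempty K) hbdd
  refine ⟨n + 1, inferInstance, K n, M₀ n, hM₀ n, hK n, fun σ _ M hM => ?_⟩
  rcases Nat.eq_zero_or_pos (Fintype.card σ) with h0 | hpos
  · have : IsEmpty σ := Fintype.card_eq_zero_iff.1 h0
    have h := Submodule.finrank_le (LinearMap.range (blockMap M))
    rw [finrank_pi_fintype, Finset.sum_const, Finset.card_univ, h0, zero_smul] at h
    rw [h0, zero_mul]
    exact h
  · obtain ⟨m, hm⟩ := Nat.exists_eq_succ_of_ne_zero hpos.ne'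
    have e : σ ≃ ZMod (m + 1) := Fintype.equivOfCardEq (by rw [hm, ZMod.card])
    rw [← finrank_range_blockMap_reindex e, hm]
    exact (hmax m _ fun a b => hM _ _).trans
      (Nat.mul_le_mul_left _ ((le_csSup hbdd ⟨m, rfl⟩).trans_eq hn.symm))

/-- The span of the images of `U` under the maps in `B`. -/
def imageSpan (B : Submodule ℂ (V →ₗ[ℂ] W)) (U : Submodule ℂ V) : Submodule ℂ W :=
  Submodule.span ℂ {w | ∃ c ∈ B, ∃ u ∈ U, c u = w}

/-- Some blow-up of `B` contains a map whose relative rank is the smallest one allowed by the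
shrunk subspaces of `B`. -/
theorem exists_blockMap_and_shrunk (B : Submodule ℂ (V →ₗ[ℂ] W)) :
    ∃ (n : ℕ) (_ : NeZero n) (k : ℕ) (M : ZMod n → ZMod n → (V →ₗ[ℂ] W)) (U : Submodule ℂ V),
      (∀ a b, M a b ∈ B) ∧ finrank ℂ (LinearMap.range (blockMap M)) = n * k ∧
      finrank ℂ V + finrank ℂ (imageSpan B U) ≤ finrank ℂ U + k := by
  classical
  obtain ⟨n, hn, k, M, hM, hk, hmax⟩ := exists_max_rank_ratio B
  let B' : Submodule ℂ ((ZMod n → V) →ₗ[ℂ] (ZMod n → W)) :=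
    { carrier := {f | ∃ N : ZMod n → ZMod n → (V →ₗ[ℂ] W), (∀ a b, N a b ∈ B) ∧ blockMap N = f}
      zero_mem' := ⟨0, fun _ _ => B.zero_mem,
        LinearMap.ext fun x => funext fun a => by simp [blockMap_apply]⟩
      add_mem' := by
        rintro _ _ ⟨N, hN, rfl⟩ ⟨N', hN', rfl⟩
        exact ⟨N + N', fun a b => B.add_mem (hN a b) (hN' a b),
          LinearMap.ext fun x => funext fun a => by
            simp [blockMap_apply, Finset.sum_add_distrib]⟩
      smul_mem' := by
        rintro c _ ⟨N, hN, rfl⟩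
        exact ⟨c • N, fun a b => B.smul_mem c (hN a b),
          LinearMap.ext fun x => funext fun a => by
            simp [blockMap_apply, Finset.smul_sum]⟩ }
  obtain ⟨U, hU, hBU⟩ := exists_map_le_map (B := B') (d := blockMap M) ⟨M, hM, rfl⟩ (by
    intro τ _ N hN
    choose N' hN' hNN' using hN
    have hN'' : N = fun s t => blockMap (N' s t) := by
      funext s t
      exact (hNN' s t).symm
    rw [hN'', finrank_range_blockMap_blockMap, hk]
    refine (hmax (τ × ZMod n) _ fun x y => hN' _ _ _ _).trans_eq ?_
    rw [Fintype.card_prod, ZMod.card, mul_assoc])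
  -- The sum of all coordinate projections of `U`. The space `B'` contains the block matrices with a
  -- single nonzero entry, so `U.map (blockMap M)` contains `imageSpan B U'` in each coordinate.
  let U' : Submodule ℂ V := ⨆ a : ZMod n, U.map (LinearMap.proj a)
  refine ⟨n, hn, k, M, U', hM, hk, ?_⟩
  have h1 : finrank ℂ U ≤ n * finrank ℂ U' := by
    have h := finrank_range_compLeft U'.subtype (ZMod n)
    rw [ZMod.card, Submodule.range_subtype] at h
    rw [← h]
    refine Submodule.finrank_mono fun u hu => ?_
    exact ⟨fun a => ⟨u a, Submodule.mem_iSup_of_mem a ⟨u, hu, rfl⟩⟩, rfl⟩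
  have h2 : n * finrank ℂ (imageSpan B U') ≤ finrank ℂ (U.map (blockMap M)) := by
    have h := finrank_range_compLeft (imageSpan B U').subtype (ZMod n)
    rw [ZMod.card, Submodule.range_subtype] at h
    rw [← h]
    refine Submodule.finrank_mono ?_
    have hsingle : ∀ a, imageSpan B U' ≤
        (U.map (blockMap M)).comap (LinearMap.single ℂ (fun _ : ZMod n => W) a) := by
      intro a
      refine Submodule.span_le.2 ?_
      rintro _ ⟨c, hc, u, hu, rfl⟩
      have : U' ≤ ((U.map (blockMap M)).comap (LinearMap.single ℂ (fun _ : ZMod n => W) a)).comap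
          c := by
        refine iSup_le fun b => Submodule.map_le_iff_le_comap.2 fun x hx => ?_
        let N : ZMod n → ZMod n → (V →ₗ[ℂ] W) := Pi.single a (Pi.single b c)
        have hN : blockMap N ∈ B' := by
          refine ⟨N, fun a' b' => ?_, rfl⟩
          simp only [N, Pi.single_apply]
          split_ifs
          · rw [Pi.single_apply]
            split_ifs
            · exact hc
            · exact B.zero_mem
          · exact B.zero_mem
        have : blockMap N x = Pi.single a (c (x b)) := by
          funext a'
          rw [blockMap_apply]
          by_cases ha : a' = a
          · subst ha
            rw [Finset.sum_eq_single b]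
            · simp [N]
            · intro b' _ hb'
              simp [N, hb']
            · simp
          · simp [N, ha]
        have h3 := hBU _ hN ⟨x, hx, rfl⟩
        rw [this] at h3
        exact h3
      exact this hu
    rintro _ ⟨w, rfl⟩
    have : (imageSpan B U').subtype.compLeft (ZMod n) w =
        ∑ a, Pi.single a ((w a : W)) := by
      funext a
      simp
    rw [this]
    exact Submodule.sum_mem _ fun a _ => hsingle a (w a).2
  have h3 := finrank_map_add_finrank_ker hU
  have h4 := LinearMap.finrank_range_add_finrank_ker (blockMap M)
  rw [hk, finrank_pi_fintype, Finset.sum_const, Finset.card_univ, ZMod.card, smul_eq_mul] at h4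
  -- Since `U` contains the kernel of `blockMap M`, the two rank-nullity identities `h3` and `h4`
  -- combine with `h1` and `h2` to give `n` times the claim.
  have hpos : 0 < n := Nat.pos_of_ne_zero hn.ne
  refine Nat.le_of_mul_le_mul_left ?_ hpos
  rw [mul_add, mul_add]
  omega

end NoncommutativeRank

/-! ### Homomorphisms from projective modules and weights -/

section Weights

variable {A : Type u} [Ring A] [Algebra ℂ A] {ι : Type w} [Fintype ι] {e : ι → A}

instance projective_pi_of_fintype {κ : Type*} [Finite κ] (P : κ → Type*) [∀ i, AddCommGroup (P i)]
    [∀ i, Module A (P i)] [∀ i, Module.Projective A (P i)] : Module.Projective A (∀ i, P i) := by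
  classical
  have := Fintype.ofFinite κ
  exact Module.Projective.of_equiv (DFinsupp.linearEquivFunOnFintype (R := A) (M := P))

omit [Algebra ℂ A] in
theorem mul_eq_of_mem_proj (he : CompleteOrthogonalIdempotents e) {i : ι} {x : A}
    (hx : x ∈ (Ideal.span {e i} : Ideal A)) : x * e i = x := by
  obtain ⟨a, rfl⟩ := Ideal.mem_span_singleton'.1 hx
  rw [mul_assoc, (he.idem i).eq]

-- Right multiplication by `e i` retracts `A` onto `A e i`.
omit [Algebra ℂ A] in
theorem projective_projSum (he : CompleteOrthogonalIdempotents e) (β : ι → ℕ) :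
    Module.Projective A (ProjSum e β) := by
  have : ∀ i, Module.Projective A (Proj e i) := fun i =>
    Module.Projective.of_split (Submodule.subtype _)
      ((LinearMap.toSpanSingleton A A (e i)).codRestrict (Ideal.span {e i}) fun a =>
        Ideal.mem_span_singleton'.2 ⟨a, rfl⟩)
      (LinearMap.ext fun x => Subtype.ext (mul_eq_of_mem_proj he x.2))
  infer_instance

section Module

variable (N : Type v) [AddCommGroup N] [Module ℂ N] [Module A N] [IsScalarTower ℂ A N]

/-- `Hom_A(A e i, N)` is `e i N`. -/
def homProjEquiv (he : CompleteOrthogonalIdempotents e) (i : ι) :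
    (Proj e i →ₗ[A] N) ≃ₗ[ℂ] LinearMap.range (Algebra.lsmul ℂ ℂ N (e i)) where
  toFun φ := ⟨φ ⟨e i, Ideal.mem_span_singleton_self _⟩, φ ⟨e i, Ideal.mem_span_singleton_self _⟩, by
    refine (map_smul φ (e i) _).symm.trans (congrArg φ ?_)
    exact Subtype.ext (he.idem i).eq⟩
  map_add' _ _ := rfl
  map_smul' _ _ := rfl
  invFun n := (LinearMap.toSpanSingleton A N n.1) ∘ₗ (Submodule.subtype _)
  left_inv φ := by
    ext x
    simp only [LinearMap.comp_apply, LinearMap.toSpanSingleton_apply, Submodule.subtype_apply]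
    rw [← map_smul]
    congr 1
    exact Subtype.ext (mul_eq_of_mem_proj he x.2)
  right_inv := by
    rintro ⟨_, n, rfl⟩
    refine Subtype.ext ?_
    simp [smul_smul, (he.idem i).eq]

/-- `Hom_A(P(β), N)` as a product. -/
def homProjSumEquiv (β : ι → ℕ) :
    (ProjSum e β →ₗ[A] N) ≃ₗ[ℂ] ((i : ι) → Fin (β i) → (Proj e i →ₗ[A] N)) :=
  letI := Classical.decEq ι
  ((LinearEquiv.piCongrRight fun i =>
    LinearMap.lsum A (fun _ : Fin (β i) => Proj e i) ℂ).trans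
      (LinearMap.lsum A (fun i => Fin (β i) → Proj e i) ℂ)).symm

variable [FiniteDimensional ℂ N]

theorem finiteDimensional_hom_proj (he : CompleteOrthogonalIdempotents e) (i : ι) :
    FiniteDimensional ℂ (Proj e i →ₗ[A] N) :=
  (homProjEquiv N he i).symm.finiteDimensional

theorem finiteDimensional_hom (he : CompleteOrthogonalIdempotents e) (β : ι → ℕ) :
    FiniteDimensional ℂ (ProjSum e β →ₗ[A] N) := by
  have := finiteDimensional_hom_proj N he
  exact (homProjSumEquiv N β).symm.finiteDimensional

theorem finrank_hom (he : CompleteOrthogonalIdempotents e) (β : ι → ℕ) :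
    finrank ℂ (ProjSum e β →ₗ[A] N) = ∑ i, β i * dimVec N e i := by
  have := finiteDimensional_hom_proj N he
  rw [(homProjSumEquiv N β).finrank_eq, finrank_pi_fintype]
  refine Finset.sum_congr rfl fun i _ => ?_
  rw [finrank_pi_fintype, Finset.sum_const, Finset.card_univ, Fintype.card_fin, smul_eq_mul,
    (homProjEquiv N he i).finrank_eq]
  rfl

/-- Since `Hom(A e i, N)` is `e i N`, the weight is the Euler characteristic of the two-term complex
of `Hom` spaces. -/
theorem weight_eq_finrank_sub (he : CompleteOrthogonalIdempotents e) (δ : ι → ℤ) :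
    weight N e δ = (finrank ℂ (ProjSum e (posPart δ) →ₗ[A] N) : ℤ) -
      finrank ℂ (ProjSum e (negPart δ) →ₗ[A] N) := by
  rw [finrank_hom N he, finrank_hom N he, weight]
  push_cast
  rw [← Finset.sum_sub_distrib]
  refine Finset.sum_congr rfl fun i _ => ?_
  rw [← sub_mul]
  congr 1
  simp only [posPart, negPart]
  omega

theorem homDim_sub_eDim (he : CompleteOrthogonalIdempotents e) {δ : ι → ℤ} (d : PHom e δ) :
    (homDim N d : ℤ) - eDim N d = weight N e δ := by
  have := finiteDimensional_hom N he
  have h1 := LinearMap.finrank_range_add_finrank_ker (presMap N d)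
  have h2 := Submodule.finrank_quotient_add_finrank (LinearMap.range (presMap N d))
  rw [weight_eq_finrank_sub N he, homDim, eDim]
  omega

omit [FiniteDimensional ℂ N] in
theorem weight_nsmul (δ : ι → ℤ) (n : ℕ) : weight N e (n • δ) = n * weight N e δ := by
  simp only [weight, Pi.smul_apply, nsmul_eq_mul, Finset.mul_sum, mul_assoc]

end Module

/-! ### Additivity and modularity of weights -/

section Exact

variable {X Y : Type v} [AddCommGroup X] [Module ℂ X] [Module A X] [IsScalarTower ℂ A X]
  [AddCommGroup Y] [Module ℂ Y] [Module A Y] [IsScalarTower ℂ A Y]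

omit [Fintype ι] in
theorem dimVec_eq_of_equiv (f : X ≃ₗ[A] Y) (i : ι) : dimVec X e i = dimVec Y e i :=
  finrank_range_conj (f.restrictScalars ℂ) (f.restrictScalars ℂ) fun x => by simp

theorem weight_eq_of_equiv (f : X ≃ₗ[A] Y) (δ : ι → ℤ) : weight X e δ = weight Y e δ := by
  simp only [weight, dimVec_eq_of_equiv (e := e) f]

omit [Fintype ι] in
theorem dimVec_submodule (L : Submodule A X) (i : ι) :
    dimVec L e i =
      finrank ℂ ((L.restrictScalars ℂ).map (Algebra.lsmul ℂ ℂ X (e i))) := by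
  have : (L.restrictScalars ℂ).map (Algebra.lsmul ℂ ℂ X (e i)) =
      (LinearMap.range (Algebra.lsmul ℂ ℂ L (e i))).map (L.subtype.restrictScalars ℂ) := by
    ext x
    constructor
    · rintro ⟨y, hy, rfl⟩
      exact ⟨e i • ⟨y, hy⟩, ⟨⟨y, hy⟩, rfl⟩, rfl⟩
    · rintro ⟨_, ⟨y, rfl⟩, rfl⟩
      exact ⟨y.1, y.2, rfl⟩
  rw [this]
  exact (Submodule.equivMapOfInjective (L.subtype.restrictScalars ℂ) Subtype.val_injective
    _).finrank_eq

variable [FiniteDimensional ℂ X]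

theorem dimVec_sup_add_dimVec_inf (he : CompleteOrthogonalIdempotents e) (L L' : Submodule A X)
    (i : ι) :
    dimVec (L ⊔ L' : Submodule A X) e i + dimVec (L ⊓ L' : Submodule A X) e i =
      dimVec L e i + dimVec L' e i := by
  simp only [dimVec_submodule]
  let E := fun K : Submodule A X => (K.restrictScalars ℂ).map (Algebra.lsmul ℂ ℂ X (e i))
  have hsup : E (L ⊔ L') = E L ⊔ E L' := by
    simp only [E]
    rw [Submodule.restrictScalars_sup, Submodule.map_sup]
  -- Images need not commute with intersections in general; here `e i` is idempotent and fixes its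
  -- image pointwise.
  have hinf : E (L ⊓ L') = E L ⊓ E L' := by
    ext x
    constructor
    · rintro ⟨y, hy, rfl⟩
      exact ⟨⟨y, hy.1, rfl⟩, ⟨y, hy.2, rfl⟩⟩
    · rintro ⟨⟨y, hy, rfl⟩, ⟨z, hz, h⟩⟩
      refine ⟨e i • y, ⟨L.smul_mem _ hy, ?_⟩, ?_⟩
      · have h' : e i • z = e i • y := h
        exact h' ▸ L'.smul_mem _ hz
      · simp [smul_smul, (he.idem i).eq]
  change finrank ℂ (E (L ⊔ L')) + finrank ℂ (E (L ⊓ L')) = _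
  rw [hsup, hinf]
  exact Submodule.finrank_sup_add_finrank_inf_eq _ _

theorem weight_sup_add_weight_inf (he : CompleteOrthogonalIdempotents e) (L L' : Submodule A X)
    (δ : ι → ℤ) :
    weight (L ⊔ L' : Submodule A X) e δ + weight (L ⊓ L' : Submodule A X) e δ =
      weight L e δ + weight L' e δ := by
  simp only [weight, ← Finset.sum_add_distrib, ← mul_add]
  refine Finset.sum_congr rfl fun i _ => ?_
  congr 1
  exact_mod_cast dimVec_sup_add_dimVec_inf he L L' i

theorem dimVec_eq_add_of_surjective (he : CompleteOrthogonalIdempotents e) (f : X →ₗ[A] Y)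
    (hf : Function.Surjective f) (i : ι) :
    dimVec X e i = dimVec (LinearMap.ker f) e i + dimVec Y e i := by
  let R := LinearMap.range (Algebra.lsmul ℂ ℂ X (e i))
  have h := LinearMap.finrank_range_add_finrank_ker ((f.restrictScalars ℂ).domRestrict R)
  have h1 : LinearMap.range ((f.restrictScalars ℂ).domRestrict R) =
      LinearMap.range (Algebra.lsmul ℂ ℂ Y (e i)) := by
    rw [LinearMap.range_domRestrict]
    ext y
    constructor
    · rintro ⟨_, ⟨x, rfl⟩, rfl⟩
      exact ⟨f x, by simp⟩
    · rintro ⟨y, rfl⟩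
      obtain ⟨x, rfl⟩ := hf y
      exact ⟨e i • x, ⟨x, rfl⟩, by simp⟩
  have h2 : (LinearMap.ker ((f.restrictScalars ℂ).domRestrict R)).map R.subtype =
      ((LinearMap.ker f).restrictScalars ℂ).map (Algebra.lsmul ℂ ℂ X (e i)) := by
    ext x
    constructor
    · rintro ⟨⟨_, x, rfl⟩, hx, rfl⟩
      refine ⟨e i • x, hx, ?_⟩
      simp [smul_smul, (he.idem i).eq]
    · rintro ⟨x, hx, rfl⟩
      refine ⟨⟨e i • x, x, rfl⟩, ?_, rfl⟩
      have hx' : f x = 0 := hx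
      show f (e i • x) = 0
      rw [map_smul, hx', smul_zero]
  rw [dimVec_submodule, ← h2,
    ← (Submodule.equivMapOfInjective R.subtype Subtype.val_injective _).finrank_eq, dimVec, dimVec,
    ← h1, add_comm]
  exact h.symm

theorem weight_eq_add_of_surjective (he : CompleteOrthogonalIdempotents e) (f : X →ₗ[A] Y)
    (hf : Function.Surjective f) (δ : ι → ℤ) :
    weight X e δ = weight (LinearMap.ker f) e δ + weight Y e δ := by
  simp only [weight, ← Finset.sum_add_distrib, ← mul_add]
  refine Finset.sum_congr rfl fun i _ => ?_
  congr 1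
  exact_mod_cast dimVec_eq_add_of_surjective he f hf i

end Exact

end Weights

/-! ### General presentations and the weights of submodules -/

section General

/-- By the Leibniz formula the determinant is a polynomial in linear forms of `x`, so its
nonvanishing locus is Zariski-open. -/
theorem forGeneral_det_ne_zero {V H : Type*} [AddCommGroup V] [Module ℂ V] [AddCommGroup H]
    [Module ℂ H] [FiniteDimensional ℂ H] (Φ : V →ₗ[ℂ] End ℂ H) {x₀ : V}
    (h : LinearMap.det (Φ x₀) ≠ 0) : ForGeneral fun x => LinearMap.det (Φ x) ≠ 0 := by
  classical
  let b := finBasis ℂ H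
  let f : V → ℂ := fun x => LinearMap.det (Φ x)
  refine ⟨{x | ∃ g ∈ ({f} : Set (V → ℂ)), g x ≠ 0}, ⟨{f}, ?_, rfl⟩, ⟨x₀, f, rfl, h⟩, ?_⟩
  · rintro _ rfl
    have hf : f = ∑ s : Equiv.Perm (Fin (finrank ℂ H)), (Equiv.Perm.sign s : ℤ) •
        ∏ i, fun x => LinearMap.toMatrix b b (Φ x) (s i) i := by
      funext x
      simp only [f, ← LinearMap.det_toMatrix b, Matrix.det_apply, Finset.sum_apply, Pi.smul_apply,
        Finset.prod_apply, Units.smul_def]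
    rw [hf]
    refine Subalgebra.sum_mem _ fun s _ => zsmul_mem (Subalgebra.prod_mem _ fun i _ => ?_) _
    refine Algebra.subset_adjoin ⟨(LinearMap.proj i ∘ₗ LinearMap.proj (s i) ∘ₗ
      (LinearMap.toMatrix b b).toLinearMap ∘ₗ Φ : V →ₗ[ℂ] ℂ), rfl⟩
  · rintro x ⟨_, rfl, hx⟩
    exact hx

variable {A : Type u} [Ring A] [Algebra ℂ A] {ι : Type w} [Fintype ι] {e : ι → A}
  (N : Type v) [AddCommGroup N] [Module ℂ N] [Module A N] [IsScalarTower ℂ A N]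

/-- The induced map on `Hom` spaces depends linearly on the presentation. -/
def presLin (e : ι → A) (δ : ι → ℤ) : PHom e δ →ₗ[ℂ]
    (ProjSum e (posPart δ) →ₗ[A] N) →ₗ[ℂ] (ProjSum e (negPart δ) →ₗ[A] N) where
  toFun d := presMap N d
  map_add' d d' := LinearMap.ext fun h => LinearMap.ext fun x => h.map_add (d x) (d' x)
  map_smul' c d := LinearMap.ext fun h => LinearMap.ext fun x => h.map_smul_of_tower c (d x)

variable [FiniteDimensional ℂ N]

/-- A left inverse `g` at `d` reduces injectivity to the nonvanishing of `det (g ∘ presMap N x)`, an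
open condition on `x`. -/
theorem genHomEq_zero (he : CompleteOrthogonalIdempotents e) {δ : ι → ℤ} {d : PHom e δ}
    (hd : homDim N d = 0) : GenHomEq N e δ 0 := by
  have := finiteDimensional_hom N he
  have hker : LinearMap.ker (presMap N d) = ⊥ := Submodule.finrank_eq_zero.1 hd
  obtain ⟨g, hg⟩ := (presMap N d).exists_leftInverse_of_injective hker
  obtain ⟨U, hU, hne, h⟩ := forGeneral_det_ne_zero (x₀ := d)
    (LinearMap.llcomp ℂ _ _ _ g ∘ₗ presLin N e δ) (by
      have : g ∘ₗ presLin N e δ d = LinearMap.id := hg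
      change LinearMap.det (g ∘ₗ presLin N e δ d) ≠ 0
      rw [this, LinearMap.det_id]
      exact one_ne_zero)
  refine ⟨U, hU, hne, fun x hx => ?_⟩
  refine Submodule.finrank_eq_zero.2 (LinearMap.ker_eq_bot'.2 fun y hy => ?_)
  have h1 : LinearMap.det (g ∘ₗ presMap N x) ≠ 0 := h x hx
  have h2 := LinearMap.ker_eq_bot'.1 (LinearMap.ker_eq_bot_of_injective
    ((LinearMap.isUnit_iff_isUnit_det _).2 (isUnit_iff_ne_zero.2 h1) |>
      (Module.End.isUnit_iff _).1).1)
  exact h2 y (by rw [LinearMap.comp_apply, hy, map_zero])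

/-- Dual to the case of `hom`, with a right inverse at `d` witnessing surjectivity. -/
theorem genEEq_zero (he : CompleteOrthogonalIdempotents e) {δ : ι → ℤ} {d : PHom e δ}
    (hd : eDim N d = 0) : GenEEq N e δ 0 := by
  have := finiteDimensional_hom N he
  have top_iff : ∀ x : PHom e δ, eDim N x = 0 ↔ LinearMap.range (presMap N x) = ⊤ := fun x => by
    rw [eDim, finrank_zero_iff, Submodule.Quotient.subsingleton_iff]
  obtain ⟨g, hg⟩ := (presMap N d).exists_rightInverse_of_surjective ((top_iff d).1 hd)
  obtain ⟨U, hU, hne, h⟩ := forGeneral_det_ne_zero (x₀ := d)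
    (LinearMap.lcomp ℂ _ g ∘ₗ presLin N e δ) (by
      have : presLin N e δ d ∘ₗ g = LinearMap.id := hg
      change LinearMap.det (presLin N e δ d ∘ₗ g) ≠ 0
      rw [this, LinearMap.det_id]
      exact one_ne_zero)
  refine ⟨U, hU, hne, fun x hx => (top_iff x).2 ?_⟩
  have h1 : LinearMap.det (presMap N x ∘ₗ g) ≠ 0 := h x hx
  have h2 := ((Module.End.isUnit_iff _).1
    ((LinearMap.isUnit_iff_isUnit_det _).2 (isUnit_iff_ne_zero.2 h1))).2
  refine LinearMap.range_eq_top.2 fun y => ?_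
  obtain ⟨z, hz⟩ := h2 y
  exact ⟨g z, hz⟩

end General

/-! ### Multiples of a weight, blow-ups of presentations, and submodules from shrunk subspaces -/

section Multiples

theorem toNat_natCast_mul (n : ℕ) (a : ℤ) : (n * a).toNat = n * a.toNat := by
  rcases le_total 0 a with ha | ha
  · rw [Int.toNat_mul (Int.natCast_nonneg n) ha, Int.toNat_natCast]
  · rw [Int.toNat_of_nonpos ha,
      Int.toNat_of_nonpos (mul_nonpos_of_nonneg_of_nonpos (Int.natCast_nonneg n) ha), mul_zero]

variable {A : Type u} [Ring A] {ι : Type w} [Fintype ι] {e : ι → A}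

omit [Fintype ι] in
theorem exists_projSum_equiv (e : ι → A) (n : ℕ) [NeZero n] {β β' : ι → ℕ}
    (h : ∀ i, β' i = n * β i) : Nonempty (ProjSum e β' ≃ₗ[A] (ZMod n → ProjSum e β)) := by
  let c := fun i => Fintype.equivOfCardEq (α := ZMod n × Fin (β i)) (β := Fin (β' i))
    (by rw [Fintype.card_prod, ZMod.card, Fintype.card_fin, Fintype.card_fin, h])
  exact ⟨{
    toFun := fun x a i k => x i (c i (a, k))
    map_add' := fun _ _ => rfl
    map_smul' := fun _ _ => rfl
    invFun := fun y i k => y ((c i).symm k).1 i ((c i).symm k).2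
    left_inv := fun x => by simp
    right_inv := fun y => by simp }⟩

variable [Algebra ℂ A] (N : Type v) [AddCommGroup N] [Module ℂ N] [Module A N]
  [IsScalarTower ℂ A N]

/-- Homomorphisms out of a module isomorphic to a power. -/
def homPowerEquiv {P Q : Type*} [AddCommGroup P] [Module A P] [AddCommGroup Q] [Module A Q]
    {σ : Type*} [Fintype σ] (f : Q ≃ₗ[A] (σ → P)) : (Q →ₗ[A] N) ≃ₗ[ℂ] (σ → (P →ₗ[A] N)) :=
  letI := Classical.decEq σ
  (LinearEquiv.congrLeft N ℂ f).trans (LinearMap.lsum A (fun _ : σ => P) ℂ).symm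

theorem homPowerEquiv_symm_apply {P Q : Type*} [AddCommGroup P] [Module A P] [AddCommGroup Q]
    [Module A Q] {σ : Type*} [Fintype σ] (f : Q ≃ₗ[A] (σ → P)) (h : σ → (P →ₗ[A] N)) (x : Q) :
    (homPowerEquiv N f).symm h x = ∑ a, h a (f x a) := by
  simp [homPowerEquiv, LinearEquiv.congrLeft]

variable [FiniteDimensional ℂ N]

/-- A blow-up of the space of maps induced by presentations of weight `δ` comes from a
presentation of weight `n δ`. -/
theorem exists_presentation_of_blockMap (he : CompleteOrthogonalIdempotents e) {δ : ι → ℤ} {n : ℕ}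
    [NeZero n] (d : ZMod n → ZMod n → PHom e δ) :
    ∃ D : PHom e (n • δ),
      homDim N D + finrank ℂ (LinearMap.range (blockMap fun a b => presMap N (d a b))) =
        n * finrank ℂ (ProjSum e (posPart δ) →ₗ[A] N) ∧
      eDim N D + finrank ℂ (LinearMap.range (blockMap fun a b => presMap N (d a b))) =
        n * finrank ℂ (ProjSum e (negPart δ) →ₗ[A] N) := by
  classical
  have := finiteDimensional_hom N he
  obtain ⟨fp⟩ := exists_projSum_equiv e n (β := posPart δ) (β' := posPart (n • δ)) fun i => by
    simp only [posPart, Pi.smul_apply, nsmul_eq_mul, toNat_natCast_mul]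
  obtain ⟨fm⟩ := exists_projSum_equiv e n (β := negPart δ) (β' := negPart (n • δ)) fun i => by
    simp only [negPart, Pi.smul_apply, nsmul_eq_mul, ← mul_neg, toNat_natCast_mul]
  -- The indices are transposed because `Hom(-, N)` is contravariant.
  let T : (ZMod n → ProjSum e (negPart δ)) →ₗ[A] (ZMod n → ProjSum e (posPart δ)) :=
    LinearMap.pi fun b => ∑ a, d a b ∘ₗ LinearMap.proj a
  let D : PHom e (n • δ) := fp.symm.toLinearMap ∘ₗ T ∘ₗ fm.toLinearMap
  have hD : finrank ℂ (LinearMap.range (blockMap fun a b => presMap N (d a b))) =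
      finrank ℂ (LinearMap.range (presMap N D)) := by
    refine finrank_range_conj (homPowerEquiv N fp).symm (homPowerEquiv N fm).symm fun h => ?_
    refine LinearMap.ext fun x => ?_
    rw [homPowerEquiv_symm_apply]
    change _ = (homPowerEquiv N fp).symm h (D x)
    rw [homPowerEquiv_symm_apply]
    simp only [D, LinearMap.comp_apply, LinearEquiv.coe_coe, LinearEquiv.apply_symm_apply, T,
      LinearMap.pi_apply, LinearMap.sum_apply, LinearMap.proj_apply, map_sum, blockMap_apply]
    rw [Finset.sum_comm]
    rfl
  have hp : finrank ℂ (ProjSum e (posPart (n • δ)) →ₗ[A] N) =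
      n * finrank ℂ (ProjSum e (posPart δ) →ₗ[A] N) := by
    rw [(homPowerEquiv N fp).finrank_eq, finrank_pi_fintype, Finset.sum_const, Finset.card_univ,
      ZMod.card, smul_eq_mul]
  have hm : finrank ℂ (ProjSum e (negPart (n • δ)) →ₗ[A] N) =
      n * finrank ℂ (ProjSum e (negPart δ) →ₗ[A] N) := by
    rw [(homPowerEquiv N fm).finrank_eq, finrank_pi_fintype, Finset.sum_const, Finset.card_univ,
      ZMod.card, smul_eq_mul]
  refine ⟨D, ?_, ?_⟩
  · rw [hD, ← hp, add_comm]
    exact LinearMap.finrank_range_add_finrank_ker (presMap N D)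
  · rw [hD, ← hm]
    exact Submodule.finrank_quotient_add_finrank (LinearMap.range (presMap N D))

/-- A shrunk subspace of the maps induced by presentations gives a submodule of large weight. -/
theorem exists_le_weight (he : CompleteOrthogonalIdempotents e) (δ : ι → ℤ)
    (U : Submodule ℂ (ProjSum e (posPart δ) →ₗ[A] N)) :
    ∃ L : Submodule A N, (finrank ℂ U : ℤ) -
      finrank ℂ (imageSpan (LinearMap.range (presLin N e δ)) U) ≤ weight L e δ := by
  classical
  have := finiteDimensional_hom N he
  let b := finBasis ℂ U
  let g : (Fin (finrank ℂ U) → ProjSum e (posPart δ)) →ₗ[A] N :=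
    LinearMap.lsum A (fun _ => ProjSum e (posPart δ)) ℂ fun j => (b j : _ →ₗ[A] N)
  have hg : ∀ x, g x = ∑ j, (b j : ProjSum e (posPart δ) →ₗ[A] N) (x j) := fun x => by simp [g]
  -- The sum of the images of all maps in `U`: every `u` in `U` factors through `L`, while `g`
  -- covers `L` by copies of `P₊`.
  let L := LinearMap.range g
  have : FiniteDimensional ℂ L := inferInstanceAs (FiniteDimensional ℂ (L.restrictScalars ℂ))
  have := finiteDimensional_hom L he
  refine ⟨L, ?_⟩
  rw [weight_eq_finrank_sub L he]
  have h1 : finrank ℂ U ≤ finrank ℂ (ProjSum e (posPart δ) →ₗ[A] L) := by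
    have hUL : ∀ u ∈ U, ∀ x, u x ∈ L := by
      intro u hu x
      have h := congrArg Subtype.val (b.sum_repr ⟨u, hu⟩)
      rw [Submodule.coe_sum] at h
      refine ⟨fun j => b.repr ⟨u, hu⟩ j • x, ?_⟩
      rw [hg, ← LinearMap.congr_fun h x, LinearMap.sum_apply]
      exact Finset.sum_congr rfl fun j _ => LinearMap.map_smul_of_tower _ _ _
    let F : U →ₗ[ℂ] (ProjSum e (posPart δ) →ₗ[A] L) :=
      { toFun := fun u => u.1.codRestrict L (hUL u.1 u.2)
        map_add' := fun _ _ => rfl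
        map_smul' := fun _ _ => rfl }
    refine LinearMap.finrank_le_finrank_of_injective (f := F) fun u u' h => ?_
    refine Subtype.ext (LinearMap.ext fun x => ?_)
    exact congrArg Subtype.val (LinearMap.congr_fun h x)
  have h2 : finrank ℂ (ProjSum e (negPart δ) →ₗ[A] L) ≤
      finrank ℂ (imageSpan (LinearMap.range (presLin N e δ)) U) := by
    have hmem : ∀ h : ProjSum e (negPart δ) →ₗ[A] L,
        L.subtype ∘ₗ h ∈ imageSpan (LinearMap.range (presLin N e δ)) U := by
      intro h
      have := projective_projSum he (negPart δ)
      -- Lifting through copies of `P₊` writes `h` as a sum of members of `U` composed with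
      -- presentations, so all of `Hom(P₋, L)` lies in the image span.
      obtain ⟨k, hk⟩ := projective_lifting_property g.rangeRestrict h g.surjective_rangeRestrict
      have : L.subtype ∘ₗ h = ∑ j, presLin N e δ (LinearMap.proj j ∘ₗ k) (b j) := by
        refine LinearMap.ext fun x => ?_
        rw [← hk]
        rw [LinearMap.sum_apply]
        exact hg (k x)
      rw [this]
      exact Submodule.sum_mem _ fun j _ => Submodule.subset_span ⟨_, ⟨_, rfl⟩, _, (b j).2, rfl⟩
    let F : (ProjSum e (negPart δ) →ₗ[A] L) →ₗ[ℂ]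
        imageSpan (LinearMap.range (presLin N e δ)) U :=
      { toFun := fun h => ⟨L.subtype ∘ₗ h, hmem h⟩
        map_add' := fun _ _ => rfl
        map_smul' := fun _ _ => rfl }
    refine LinearMap.finrank_le_finrank_of_injective (f := F) fun h h' hh => ?_
    refine LinearMap.ext fun x => Subtype.ext ?_
    exact LinearMap.congr_fun (congrArg Subtype.val hh) x
  omega

/-- The dimension of the general `Hom` spaces is governed by the weights of submodules. -/
theorem exists_presentation_and_submodule (he : CompleteOrthogonalIdempotents e) (δ : ι → ℤ) :
    ∃ (n k : ℕ) (D : PHom e (n • δ)) (L : Submodule A N), 0 < n ∧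
      homDim N D + n * k = n * finrank ℂ (ProjSum e (posPart δ) →ₗ[A] N) ∧
      eDim N D + n * k = n * finrank ℂ (ProjSum e (negPart δ) →ₗ[A] N) ∧
      (finrank ℂ (ProjSum e (posPart δ) →ₗ[A] N) : ℤ) - k ≤ weight L e δ := by
  have := finiteDimensional_hom N he
  obtain ⟨n, hn, k, M, U, hM, hk, hU⟩ :=
    exists_blockMap_and_shrunk (LinearMap.range (presLin N e δ))
  choose d hd using hM
  obtain ⟨D, h1, h2⟩ := exists_presentation_of_blockMap N he d
  have hMd : M = fun a b => presMap N (d a b) := funext fun a => funext fun b => (hd a b).symm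
  rw [← hMd, hk] at h1 h2
  obtain ⟨L, hL⟩ := exists_le_weight N he δ U
  exact ⟨n, k, D, L, Nat.pos_of_ne_zero hn.ne, h1, h2, by omega⟩

end Multiples

/-! ### Torsion pairs -/

theorem le_of_mkQ_comp_subtype_eq_zero {R M : Type*} [Ring R] [AddCommGroup M] [Module R M]
    {K L : Submodule R M} (h : L.mkQ ∘ₗ K.subtype = 0) : K ≤ L := fun x hx =>
  (Submodule.Quotient.mk_eq_zero L).1 (LinearMap.congr_fun h ⟨x, hx⟩)

section TorsionPairs

variable {A : Type u} [Ring A] [Algebra ℂ A] {ι : Type w} [Fintype ι] {e : ι → A}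

/-! ### Membership in the two classes in terms of weights -/

section Membership

variable {N : Type v} [AddCommGroup N] [Module ℂ N] [Module A N] [IsScalarTower ℂ A N]

theorem finiteDimensional_submodule [FiniteDimensional ℂ N] (L : Submodule A N) :
    FiniteDimensional ℂ L :=
  inferInstanceAs (FiniteDimensional ℂ (L.restrictScalars ℂ))

theorem finiteDimensional_quotient [FiniteDimensional ℂ N] (L : Submodule A N) :
    FiniteDimensional ℂ (N ⧸ L) :=
  Module.Finite.of_surjective (L.mkQ.restrictScalars ℂ) L.mkQ_surjective

theorem weight_quotient [FiniteDimensional ℂ N] (he : CompleteOrthogonalIdempotents e)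
    (L : Submodule A N) (δ : ι → ℤ) :
    weight N e δ = weight L e δ + weight (N ⧸ L) e δ := by
  rw [weight_eq_add_of_surjective he L.mkQ L.mkQ_surjective,
    weight_eq_of_equiv (LinearEquiv.ofEq _ _ L.ker_mkQ)]

theorem weight_map_subtype (L : Submodule A N) (K : Submodule A L) (δ : ι → ℤ) :
    weight (K.map L.subtype) e δ = weight K e δ :=
  (weight_eq_of_equiv (Submodule.equivMapOfInjective L.subtype L.subtype_injective K) δ).symm

theorem weight_comap_mkQ [FiniteDimensional ℂ N] (he : CompleteOrthogonalIdempotents e)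
    (L : Submodule A N) (K : Submodule A (N ⧸ L)) (δ : ι → ℤ) :
    weight (K.comap L.mkQ) e δ = weight L e δ + weight K e δ := by
  have := finiteDimensional_submodule (K.comap L.mkQ)
  let f : K.comap L.mkQ →ₗ[A] K := L.mkQ.restrict fun _ hx => hx
  have hf : Function.Surjective f := by
    rintro ⟨y, hy⟩
    obtain ⟨x, rfl⟩ := L.mkQ_surjective y
    exact ⟨⟨x, hy⟩, rfl⟩
  have hker : (LinearMap.ker f).map (K.comap L.mkQ).subtype = L := by
    ext x
    constructor
    · rintro ⟨⟨y, hy⟩, hy', rfl⟩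
      exact (Submodule.Quotient.mk_eq_zero L).1 (congrArg Subtype.val hy')
    · intro hx
      have h0 : L.mkQ x = 0 := (Submodule.Quotient.mk_eq_zero L).2 hx
      exact ⟨⟨x, by rw [Submodule.mem_comap, h0]; exact K.zero_mem⟩, Subtype.ext h0, rfl⟩
  rw [weight_eq_add_of_surjective he f hf, ← weight_map_subtype, hker]

theorem weight_range [FiniteDimensional ℂ N] (he : CompleteOrthogonalIdempotents e)
    {Y : Type v} [AddCommGroup Y] [Module ℂ Y] [Module A Y] [IsScalarTower ℂ A Y]
    (f : N →ₗ[A] Y) (δ : ι → ℤ) :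
    weight N e δ = weight (LinearMap.ker f) e δ + weight (LinearMap.range f) e δ := by
  rw [weight_eq_add_of_surjective he f.rangeRestrict f.surjective_rangeRestrict,
    weight_eq_of_equiv (LinearEquiv.ofEq _ _ f.ker_rangeRestrict)]

/-- `𝓕(δ̄)` consists of the representations all of whose subrepresentations have non-positive
weight. -/
theorem barF_iff (he : CompleteOrthogonalIdempotents e) (δ : ι → ℤ) :
    barF e δ N ↔ FiniteDimensional ℂ N ∧ ∀ L : Submodule A N, weight L e δ ≤ 0 := by
  constructor
  · rintro ⟨hN, n, hn, U, -, ⟨d, hd⟩, hU⟩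
    refine ⟨hN, fun L => ?_⟩
    have := finiteDimensional_submodule L
    have := finiteDimensional_hom N he
    have := finiteDimensional_hom L he
    have hinj := LinearMap.ker_eq_bot'.1 (Submodule.finrank_eq_zero.1 (hU d hd))
    have h0 : homDim L d = 0 := by
      refine Submodule.finrank_eq_zero.2 (LinearMap.ker_eq_bot'.2 fun h hh => ?_)
      refine LinearMap.ext fun x => Subtype.ext ?_
      have : L.subtype ∘ₗ h = 0 := hinj _ (LinearMap.ext fun y =>
        congrArg Subtype.val (LinearMap.congr_fun hh y))
      exact LinearMap.congr_fun this x
    have h1 := homDim_sub_eDim L he d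
    rw [h0, weight_nsmul] at h1
    have h2 : (n : ℤ) * weight L e δ ≤ 0 := by omega
    exact nonpos_of_mul_nonpos_right h2 (by exact_mod_cast hn)
  · rintro ⟨hN, h⟩
    obtain ⟨n, k, D, L, hn, h1, -, hL⟩ := exists_presentation_and_submodule N he δ
    -- The weight of `L` is nonpositive, so `k` is at least the full dimension of `Hom(P₊, N)`,
    -- which leaves `D` no kernel.
    have hk : finrank ℂ (ProjSum e (posPart δ) →ₗ[A] N) ≤ k := by have := h L; omega
    exact ⟨hN, n, hn, genHomEq_zero N he (d := D)
      (by have := Nat.mul_le_mul_left n hk; omega)⟩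

/-- `𝓣̌(δ̄)` consists of the representations whose weight is maximal among the weights of their
subrepresentations. -/
theorem checkT_iff (he : CompleteOrthogonalIdempotents e) (δ : ι → ℤ) :
    checkT e δ N ↔
      FiniteDimensional ℂ N ∧ ∀ L : Submodule A N, weight L e δ ≤ weight N e δ := by
  constructor
  · rintro ⟨hN, n, hn, U, -, ⟨d, hd⟩, hU⟩
    refine ⟨hN, fun L => ?_⟩
    have := finiteDimensional_quotient L
    have := finiteDimensional_hom N he
    have := finiteDimensional_hom (N ⧸ L) he
    have hsurj : LinearMap.range (presMap N d) = ⊤ :=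
      Submodule.Quotient.subsingleton_iff.1 (finrank_zero_iff.1 (hU d hd))
    have h0 : eDim (N ⧸ L) d = 0 := by
      refine finrank_zero_iff.2 (Submodule.Quotient.subsingleton_iff.2
        (LinearMap.range_eq_top.2 fun h => ?_))
      have := projective_projSum he (negPart (n • δ))
      obtain ⟨h', hh'⟩ := projective_lifting_property L.mkQ h L.mkQ_surjective
      obtain ⟨g, hg⟩ := LinearMap.range_eq_top.1 hsurj h'
      refine ⟨L.mkQ ∘ₗ g, ?_⟩
      rw [← hh', ← hg]
      rfl
    have h1 := homDim_sub_eDim (N ⧸ L) he d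
    rw [h0, weight_nsmul] at h1
    have h2 : 0 ≤ (n : ℤ) * weight (N ⧸ L) e δ := by omega
    have h3 := nonneg_of_mul_nonneg_right h2 (by exact_mod_cast hn)
    rw [weight_quotient he L]
    omega
  · rintro ⟨hN, h⟩
    obtain ⟨n, k, D, L, hn, -, h2, hL⟩ := exists_presentation_and_submodule N he δ
    -- Subtracting the weight of `N` from the bound for `L` turns it into a bound on `Hom(P₋, N)`,
    -- which leaves `D` no cokernel.
    have hk : finrank ℂ (ProjSum e (negPart δ) →ₗ[A] N) ≤ k := by
      have := h L
      rw [weight_eq_finrank_sub N he] at this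
      omega
    exact ⟨hN, n, hn, genEEq_zero N he (d := D)
      (by have := Nat.mul_le_mul_left n hk; omega)⟩

end Membership

/-! ### Extremal maximisers of the weight and the torsion parts -/

section Extremal

variable {M : Type v} [AddCommGroup M] [Module ℂ M] [Module A M] [IsScalarTower ℂ A M]

theorem weight_bot (δ : ι → ℤ) : weight (⊥ : Submodule A M) e δ = 0 := by
  refine Finset.sum_eq_zero fun i _ => ?_
  have : dimVec (⊥ : Submodule A M) e i = 0 := by
    rw [dimVec, finrank_zero_iff]
    infer_instance
  rw [this, Nat.cast_zero, mul_zero]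

variable [FiniteDimensional ℂ M]

theorem nonempty_maxSubs (e : ι → A) (δ : ι → ℤ) : (maxSubs M e δ).Nonempty := by
  have hb : ∀ L : Submodule A M, weight L e δ ≤ ∑ i, |δ i| * finrank ℂ M := by
    intro L
    have := finiteDimensional_submodule L
    refine Finset.sum_le_sum fun i _ => ?_
    have h1 : dimVec L e i ≤ finrank ℂ M :=
      (Submodule.finrank_le _).trans (Submodule.finrank_le (L.restrictScalars ℂ))
    calc δ i * (dimVec L e i : ℤ) ≤ |δ i| * dimVec L e i :=
          mul_le_mul_of_nonneg_right (le_abs_self _) (Int.natCast_nonneg _)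
      _ ≤ |δ i| * finrank ℂ M :=
          mul_le_mul_of_nonneg_left (by exact_mod_cast h1) (abs_nonneg _)
  obtain ⟨m, ⟨L, hL⟩, hm⟩ := Int.exists_greatest_of_bdd
    (P := fun z => ∃ L : Submodule A M, weight L e δ = z)
    ⟨_, fun z ⟨L, hL⟩ => hL ▸ hb L⟩ ⟨_, ⊥, rfl⟩
  exact ⟨L, fun L' => hL ▸ hm _ ⟨L', rfl⟩⟩

/-- By modularity the weights of the sum and the intersection add up to twice the maximum, so
neither can fall short. -/
theorem sup_inf_mem_maxSubs (he : CompleteOrthogonalIdempotents e) {δ : ι → ℤ}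
    {L L' : Submodule A M} (hL : L ∈ maxSubs M e δ) (hL' : L' ∈ maxSubs M e δ) :
    L ⊔ L' ∈ maxSubs M e δ ∧ L ⊓ L' ∈ maxSubs M e δ := by
  have h := weight_sup_add_weight_inf he L L' δ
  have h1 := hL (L ⊔ L')
  have h2 := hL' (L ⊓ L')
  have h3 := hL' (L ⊔ L')
  have h4 := hL (L ⊓ L')
  exact ⟨fun K => by have := hL K; omega, fun K => by have := hL K; omega⟩

theorem exists_isLeast_maxSubs (he : CompleteOrthogonalIdempotents e) (δ : ι → ℤ) :
    ∃ L, IsLeast (maxSubs M e δ) L := by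
  have : IsArtinian A M := isArtinian_of_tower ℂ inferInstance
  obtain ⟨L, hL, hmin⟩ := wellFounded_lt.has_min (maxSubs M e δ) (nonempty_maxSubs e δ)
  refine ⟨L, hL, fun L' hL' => ?_⟩
  have h := hmin _ (sup_inf_mem_maxSubs he hL hL').2
  exact inf_eq_left.1 (eq_of_le_of_not_lt inf_le_left h)

theorem exists_isGreatest_maxSubs (he : CompleteOrthogonalIdempotents e) (δ : ι → ℤ) :
    ∃ L, IsGreatest (maxSubs M e δ) L := by
  have : IsNoetherian A M := isNoetherian_of_tower ℂ inferInstance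
  obtain ⟨L, hL, hmax⟩ := wellFounded_gt.has_min (maxSubs M e δ) (nonempty_maxSubs e δ)
  refine ⟨L, hL, fun L' hL' => ?_⟩
  have h := hmax _ (sup_inf_mem_maxSubs he hL hL').1
  exact sup_eq_left.1 (eq_of_le_of_not_lt le_sup_left h).symm

theorem quotient_mem_barF (he : CompleteOrthogonalIdempotents e) {δ : ι → ℤ} {L : Submodule A M}
    (hL : L ∈ maxSubs M e δ) : barF e δ (M ⧸ L) := by
  refine (barF_iff he δ).2 ⟨finiteDimensional_quotient L, fun K => ?_⟩
  have h1 := weight_comap_mkQ he L K δ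
  have h2 := hL (K.comap L.mkQ)
  omega

theorem mem_checkT_of_mem_maxSubs (he : CompleteOrthogonalIdempotents e) {δ : ι → ℤ}
    {L : Submodule A M} (hL : L ∈ maxSubs M e δ) : checkT e δ L := by
  refine (checkT_iff he δ).2 ⟨finiteDimensional_submodule L, fun K => ?_⟩
  rw [← weight_map_subtype]
  exact hL _

/-- The image of a map to an object of `barF` has nonpositive weight, so the kernel is again a
maximiser. Minimality forces the kernel to be everything. -/
theorem mem_barT_of_isLeast (he : CompleteOrthogonalIdempotents e) {δ : ι → ℤ}
    {L : Submodule A M} (hL : IsLeast (maxSubs M e δ) L) : barT e δ L := by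
  have := finiteDimensional_submodule L
  refine ⟨this, fun N _ _ _ _ hN φ => ?_⟩
  have h1 := weight_range he φ δ
  have h2 := ((barF_iff he δ).1 hN).2 (LinearMap.range φ)
  have h3 : (LinearMap.ker φ).map L.subtype ∈ maxSubs M e δ := by
    intro K
    have h4 := hL.1 K
    rw [weight_map_subtype]
    omega
  have h4 := hL.2 h3
  refine LinearMap.ext fun x => ?_
  obtain ⟨y, hy, hyx⟩ := h4 x.2
  rw [← Subtype.ext hyx]
  exact hy

/-- The image of a map from an object of `checkT` has nonnegative weight, so its preimage in `M` is
a maximiser. Maximality puts that preimage inside `L`, and the map vanishes. -/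
theorem quotient_mem_checkF_of_isGreatest (he : CompleteOrthogonalIdempotents e) {δ : ι → ℤ}
    {L : Submodule A M} (hL : IsGreatest (maxSubs M e δ) L) : checkF e δ (M ⧸ L) := by
  refine ⟨finiteDimensional_quotient L, fun X _ _ _ _ hX φ => ?_⟩
  obtain ⟨hXf, hX⟩ := (checkT_iff he δ).1 hX
  have h1 := weight_range he φ δ
  have h2 := hX (LinearMap.ker φ)
  have h3 := weight_comap_mkQ he L (LinearMap.range φ) δ
  have h4 : (LinearMap.range φ).comap L.mkQ ∈ maxSubs M e δ := by
    intro K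
    have := hL.1 K
    omega
  have h5 := hL.2 h4
  refine LinearMap.ext fun x => ?_
  obtain ⟨y, hy⟩ := L.mkQ_surjective (φ x)
  have h6 : y ∈ L := h5 (by rw [Submodule.mem_comap, hy]; exact ⟨x, rfl⟩)
  rw [← hy, LinearMap.zero_apply]
  exact (Submodule.Quotient.mk_eq_zero L).2 h6

theorem torsionSub_barT (he : CompleteOrthogonalIdempotents e) {δ : ι → ℤ}
    {L : Submodule A M} (hL : IsLeast (maxSubs M e δ) L) : torsionSub M (barT e δ) = L :=
  le_antisymm
    (sSup_le fun _ hK => le_of_mkQ_comp_subtype_eq_zero (hK.2 _ (quotient_mem_barF he hL.1) _))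
    (le_sSup (mem_barT_of_isLeast he hL))

theorem torsionSub_checkT (he : CompleteOrthogonalIdempotents e) {δ : ι → ℤ}
    {L : Submodule A M} (hL : IsGreatest (maxSubs M e δ) L) : torsionSub M (checkT e δ) = L :=
  le_antisymm
    (sSup_le fun _ hK => le_of_mkQ_comp_subtype_eq_zero
      ((quotient_mem_checkF_of_isGreatest he hL).2 _ hK _))
    (le_sSup (mem_checkT_of_mem_maxSubs he hL.1))

end Extremal

theorem isTorsionPair_bar (he : CompleteOrthogonalIdempotents e) (δ : ι → ℤ) :
    IsTorsionPair.{u, v} (barT e δ) (barF e δ) where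
  mem_left_iff _ _ _ _ _ := Iff.rfl
  mem_right_iff Y _ _ _ _ := by
    refine ⟨fun hY => ⟨hY.1, fun L _ _ _ _ hL φ => hL.2 Y hY φ⟩, fun hY => ?_⟩
    have := hY.1
    obtain ⟨L, hL⟩ := exists_isLeast_maxSubs (M := Y) he δ
    -- The least maximiser of `Y` lies in `barT`, so its inclusion is zero; hence the maximal weight
    -- in `Y` is that of the zero submodule.
    have h0 : L.subtype = 0 := hY.2 L (mem_barT_of_isLeast he hL) _
    have hbot : L = ⊥ := (Submodule.eq_bot_iff L).2 fun x hx => LinearMap.congr_fun h0 ⟨x, hx⟩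
    refine (barF_iff he δ).2 ⟨this, fun K => (hL.1 K).trans ?_⟩
    subst hbot
    exact (weight_bot δ).le

theorem isTorsionPair_check (he : CompleteOrthogonalIdempotents e) (δ : ι → ℤ) :
    IsTorsionPair.{u, v} (checkT e δ) (checkF e δ) where
  mem_left_iff X _ _ _ _ := by
    refine ⟨fun hX => ⟨hX.1, fun N _ _ _ _ hN φ => hN.2 X hX φ⟩, fun hX => ?_⟩
    have := hX.1
    obtain ⟨L, hL⟩ := exists_isGreatest_maxSubs (M := X) he δ
    -- The quotient of `X` by its greatest maximiser lies in `checkF`, so the projection is zero and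
    -- `X` itself has maximal weight.
    have h0 : L.mkQ = 0 := hX.2 _ (quotient_mem_checkF_of_isGreatest he hL) _
    have htop : L = ⊤ := by rw [← L.ker_mkQ, h0, LinearMap.ker_zero]
    refine (checkT_iff he δ).2 ⟨this, fun K => (hL.1 K).trans_eq ?_⟩
    subst htop
    exact weight_eq_of_equiv Submodule.topEquiv δ
  mem_right_iff _ _ _ _ _ := Iff.rfl

end TorsionPairs

end

end TorsionTheory

theorem theoremT {A : Type u} [Ring A] [Algebra ℂ A] [FiniteDimensional ℂ A]
    {ι : Type w} [Fintype ι] (e : ι → A) (he : TorsionTheory.IsBasicVertexSet e)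
    (M : Type v) [AddCommGroup M] [Module ℂ M] [Module A M] [IsScalarTower ℂ A M]
    [FiniteDimensional ℂ M] (δ : ι → ℤ) :
    TorsionTheory.IsTorsionPair.{u, v} (TorsionTheory.barT e δ) (TorsionTheory.barF e δ) ∧
    TorsionTheory.IsTorsionPair.{u, v} (TorsionTheory.checkT e δ) (TorsionTheory.checkF e δ) ∧
    ∃ Lmin Lmax : Submodule A M,
      IsLeast (TorsionTheory.maxSubs M e δ) Lmin ∧
      IsGreatest (TorsionTheory.maxSubs M e δ) Lmax ∧
      TorsionTheory.torsionSub M (TorsionTheory.barT e δ) = Lmin ∧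
      (∃ g : TorsionTheory.torsionFreeQuot M (TorsionTheory.barT e δ) ≃ₗ[A] M ⧸ Lmin,
        ∀ m : M, g (Submodule.Quotient.mk m) = Submodule.Quotient.mk m) ∧
      TorsionTheory.torsionSub M (TorsionTheory.checkT e δ) = Lmax ∧
      (∃ g : TorsionTheory.torsionFreeQuot M (TorsionTheory.checkT e δ) ≃ₗ[A] M ⧸ Lmax,
        ∀ m : M, g (Submodule.Quotient.mk m) = Submodule.Quotient.mk m) ∧
      ∀ L ∈ TorsionTheory.maxSubs M e δ,
        (∀ φ : TorsionTheory.torsionSub M (TorsionTheory.barT e δ) →ₗ[A] M ⧸ L, φ = 0) ∧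
        (∀ φ : L →ₗ[A] TorsionTheory.torsionFreeQuot M (TorsionTheory.checkT e δ), φ = 0) := by
  have hc := he.complete
  obtain ⟨Lmin, hmin⟩ := TorsionTheory.exists_isLeast_maxSubs (M := M) hc δ
  obtain ⟨Lmax, hmax⟩ := TorsionTheory.exists_isGreatest_maxSubs (M := M) hc δ
  have h1 := TorsionTheory.torsionSub_barT hc hmin
  have h2 := TorsionTheory.torsionSub_checkT hc hmax
  refine ⟨TorsionTheory.isTorsionPair_bar hc δ, TorsionTheory.isTorsionPair_check hc δ, Lmin, Lmax,
    hmin, hmax, h1, ⟨Submodule.quotEquivOfEq _ _ h1, fun _ => rfl⟩, h2,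
    ⟨Submodule.quotEquivOfEq _ _ h2, fun _ => rfl⟩, fun L hL => ⟨?_, ?_⟩⟩
  · rw [h1]
    exact (TorsionTheory.mem_barT_of_isLeast hc hmin).2 _
      (TorsionTheory.quotient_mem_barF hc hL)
  · change ∀ φ : L →ₗ[A] M ⧸ TorsionTheory.torsionSub M (TorsionTheory.checkT e δ), φ = 0
    rw [h2]
    exact (TorsionTheory.quotient_mem_checkF_of_isGreatest hc hmax).2 _
      (TorsionTheory.mem_checkT_of_mem_maxSubs hc hL)
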